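/- Let $n\ge 2$ be an integer; all vector spaces and algebras are over $\mathbb{C}$. Let $A_n=\mathbb{C}[x_1^{\pm1},\dots,x_n^{\pm1}]$, $\partial_i=x_i\frac{\partial}{\partial x_i}$, and let $\mathcal{K}_n$ be the Weyl algebra over $A_n$, i.e. the algebra of differential operators on $A_n$ generated by (multiplication by) the monomials $x^r$, $r\in\mathbb{Z}^n$, and by $\partial_1,\dots,\partial_n$. For $u\in\mathbb{C}^n$ and $r\in\mathbb{Z}^n$ put $(u|r)=\sum_i u_ir_i$ and $D(u,r)=x^r\sum_i u_i\partial_i$, and let $\mathbb{S}_n=\operatorname{span}\{D(u,r) : (u|r)=0\}\subset \operatorname{Der}(A_n)$ be the Lie algebra of divergence zero vector fields on the $n$-dimensional torus. For a $\mathcal{K}_n$-module $P$ and an $\mathfrak{sl}_n$-module $V$ let $\mathcal{F}(P,V)=P\otimes V$ be the $\mathbb{S}_n$-module with action $$D(u,r)(z\otimes y)=D(u,r)z\otimes y+x^rz\otimes (ru^T)y,\qquad (u|r)=0,\ z\in P,\ y\in V.$$ For $0\le k\le n-1$ let $V(\delta_k)=\bigwedge^k(\mathbb{C}^n)$ be the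 $k$-th exterior power of the natural $\mathfrak{sl}_n$-module. Let $P,P'$ be irreducible $\mathcal{K}_n$-modules and $V,V'$ irreducible $\mathfrak{sl}_n$-modules (not necessarily finite-dimensional or weight modules), and suppose that $V\not\cong V(\delta_k)$ for $k=0,1,\dots,n-1$. Then $\mathcal{F}(P,V)\cong\mathcal{F}(P',V')$ as $\mathbb{S}_n$-modules if and only if $P\cong P'$ as $\mathcal{K}_n$-modules and $V\cong V'$ as $\mathfrak{sl}_n$-modules. (In particular, this applies to any two nonminuscule modules, i.e. to modules $\mathcal{F}(P,V)$, $\mathcal{F}(P',V')$ with neither $V$ nor $V'$ isomorphic to any $V(\delta_k)$, $0\le k\le n-1$.) -/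

import Mathlib

open scoped TensorProduct

noncomputable section

namespace TorusVF

/-- The Laurent polynomial algebra `A_n = ℂ[x₁^{±1}, …, xₙ^{±1}]`, the group algebra of `ℤⁿ`. -/
abbrev Laurent (n : ℕ) : Type := AddMonoidAlgebra ℂ (Fin n → ℤ)

/-- The monomial `x^r`. -/
def mono {n : ℕ} (r : Fin n → ℤ) : Laurent n := AddMonoidAlgebra.single r 1

/-- The bilinear pairing `(u | r) = ∑ i, u i * r i` of `u ∈ ℂⁿ` with `r ∈ ℤⁿ`. -/
def pair {n : ℕ} (u : Fin n → ℂ) (r : Fin n → ℤ) : ℂ := ∑ i, u i * (r i : ℂ)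

theorem mono_mul {n : ℕ} (r s : Fin n → ℤ) : mono r * mono s = mono (r + s) := by
  simp [mono, AddMonoidAlgebra.single_mul_single]

theorem laurent_induction {n : ℕ} {p : Laurent n → Prop} (f : Laurent n)
    (hm : ∀ r, p (mono r)) (h0 : p 0) (ha : ∀ f g, p f → p g → p (f + g))
    (hs : ∀ (c : ℂ) f, p f → p (c • f)) : p f := by
  induction f using AddMonoidAlgebra.induction_linear with
  | zero => exact h0
  | add f g hf hg => exact ha f g hf hg
  | single r c =>
    have := hs c _ (hm r)
    simpa [mono] using this

/-- The linear map `∂ᵢ = xᵢ ∂/∂xᵢ`, that is `x^r ↦ rᵢ x^r`. -/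
def eulerLin {n : ℕ} (i : Fin n) : Laurent n →ₗ[ℂ] Laurent n :=
  (Finsupp.linearCombination ℂ fun r : Fin n → ℤ => (r i : ℂ) • mono r) ∘ₗ
    (AddMonoidAlgebra.coeffLinearEquiv ℂ).toLinearMap

theorem eulerLin_mono {n : ℕ} (i : Fin n) (r : Fin n → ℤ) :
    eulerLin i (mono r) = (r i : ℂ) • mono r := by
  simp [eulerLin, mono]

theorem eulerLin_mul {n : ℕ} (i : Fin n) (f g : Laurent n) :
    eulerLin i (f * g) = f • eulerLin i g + g • eulerLin i f := by
  induction f using laurent_induction with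
  | hm r =>
    induction g using laurent_induction with
    | hm s =>
      simp only [mono_mul, eulerLin_mono, smul_eq_mul, mul_smul_comm, add_comm s r, ← add_smul]
      simp [add_comm]
    | h0 => simp
    | ha f g hf hg => simp only [mul_add, map_add, hf, hg, smul_add, add_smul]; abel
    | hs c f hf =>
      simp only [mul_smul_comm, smul_mul_assoc, map_smul, hf, smul_add, smul_eq_mul]
  | h0 => simp
  | ha f g hf hg => simp only [add_mul, map_add, hf, hg, smul_add, add_smul]; abel
  | hs c f hf => simp only [smul_mul_assoc, mul_smul_comm, map_smul, hf, smul_add, smul_eq_mul]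

/-- The derivation `∂ᵢ = xᵢ ∂/∂xᵢ` of `A_n`. -/
def euler {n : ℕ} (i : Fin n) : Derivation ℂ (Laurent n) (Laurent n) :=
  Derivation.mk' (eulerLin i) (eulerLin_mul i)

/-- The vector field `D(u, r) = x^r ∑ i, u i ∂ᵢ`, an element of `W_n = Der(A_n)`. -/
def vf {n : ℕ} (u : Fin n → ℂ) (r : Fin n → ℤ) : Derivation ℂ (Laurent n) (Laurent n) :=
  mono r • ∑ i, u i • euler i

theorem derivation_sum_apply {n : ℕ} {ι : Type*} (t : Finset ι)
    (D : ι → Derivation ℂ (Laurent n) (Laurent n)) (f : Laurent n) :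
    (∑ i ∈ t, D i) f = ∑ i ∈ t, D i f := by
  classical
  induction t using Finset.induction_on with
  | empty => simp
  | insert a t ha ih => simp [Finset.sum_insert ha, ih]

theorem vf_mono {n : ℕ} (u : Fin n → ℂ) (r s : Fin n → ℤ) :
    vf u r (mono s) = pair u s • mono (r + s) := by
  rw [vf, Derivation.smul_apply, derivation_sum_apply]
  simp only [Derivation.smul_apply, euler, Derivation.coe_mk', eulerLin_mono, pair,
    Finset.mul_sum, Finset.sum_smul, smul_eq_mul, mul_smul_comm, mono_mul, smul_smul]

theorem derivation_ext {n : ℕ} {D E : Derivation ℂ (Laurent n) (Laurent n)}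
    (h : ∀ s, D (mono s) = E (mono s)) : D = E := by
  refine Derivation.ext fun f => ?_
  induction f using laurent_induction with
  | hm r => exact h r
  | h0 => simp
  | ha f g hf hg => rw [map_add, map_add, hf, hg]
  | hs c f hf => rw [Derivation.map_smul, Derivation.map_smul, hf]

theorem pair_add_right {n : ℕ} (u : Fin n → ℂ) (r s : Fin n → ℤ) :
    pair u (r + s) = pair u r + pair u s := by
  simp [pair, mul_add, Finset.sum_add_distrib]

theorem pair_sub_left {n : ℕ} (u v : Fin n → ℂ) (r : Fin n → ℤ) :
    pair (u - v) r = pair u r - pair v r := by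
  simp [pair, sub_mul, Finset.sum_sub_distrib]

theorem pair_smul_left {n : ℕ} (c : ℂ) (u : Fin n → ℂ) (r : Fin n → ℤ) :
    pair (c • u) r = c * pair u r := by
  simp [pair, Finset.mul_sum, mul_assoc]

/-- `[D(u,r), D(v,s)] = D((u|s) v - (v|r) u, r + s)`. -/
theorem vf_lie {n : ℕ} (u v : Fin n → ℂ) (r s : Fin n → ℤ) :
    ⁅vf u r, vf v s⁆ = vf (pair u s • v - pair v r • u) (r + s) := by
  refine derivation_ext fun t => ?_
  simp only [Derivation.commutator_apply, vf_mono, Derivation.map_smul, smul_smul, pair_sub_left,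
    pair_smul_left, pair_add_right]
  rw [show s + (r + t) = r + s + t by abel, show r + (s + t) = r + s + t by abel, ← sub_smul]
  congr 1
  ring

/-- The set of all `D(u, r)` with `(u | r) = 0`. -/
def divFreeGen (n : ℕ) : Set (Derivation ℂ (Laurent n) (Laurent n)) :=
  {D | ∃ (u : Fin n → ℂ) (r : Fin n → ℤ), pair u r = 0 ∧ D = vf u r}

/-- The Lie algebra `𝕊_n` of divergence zero vector fields on the torus, the linear span of all
`D(u, r)` with `(u | r) = 0`. -/
def divFree (n : ℕ) : LieSubalgebra ℂ (Derivation ℂ (Laurent n) (Laurent n)) where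
  __ := Submodule.span ℂ (divFreeGen n)
  lie_mem' := by
    intro D E hD hE
    change D ∈ Submodule.span ℂ (divFreeGen n) at hD
    change E ∈ Submodule.span ℂ (divFreeGen n) at hE
    change ⁅D, E⁆ ∈ Submodule.span ℂ (divFreeGen n)
    induction hD, hE using Submodule.span_induction₂ with
    | mem_mem D E hD hE =>
      obtain ⟨u, r, hu, rfl⟩ := hD
      obtain ⟨v, s, hv, rfl⟩ := hE
      refine Submodule.subset_span ⟨_, _, ?_, vf_lie u v r s⟩
      simp only [pair_sub_left, pair_smul_left, pair_add_right, hu, hv]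
      ring
    | zero_left E => rw [show ⁅(0 : Derivation ℂ (Laurent n) (Laurent n)), E⁆ = 0 from zero_lie E]; exact zero_mem _
    | zero_right D => rw [show ⁅D, (0 : Derivation ℂ (Laurent n) (Laurent n))⁆ = 0 from lie_zero D]; exact zero_mem _
    | add_left D D' E _ _ _ h h' => exact (add_lie D D' E).symm ▸ add_mem h h'
    | add_right D E E' _ _ _ h h' => exact (lie_add D E E').symm ▸ add_mem h h'
    | smul_left c D E _ _ h => exact (smul_lie c D E).symm ▸ Submodule.smul_mem _ _ h
    | smul_right c D E _ _ h => exact (lie_smul c D E).symm ▸ Submodule.smul_mem _ _ h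

/-- `D(u, r)` as an element of `𝕊_n`. -/
def divFree.D {n : ℕ} (u : Fin n → ℂ) (r : Fin n → ℤ) (h : pair u r = 0) : divFree n :=
  ⟨vf u r, Submodule.subset_span ⟨u, r, h, rfl⟩⟩

theorem divFree_induction {n : ℕ} {p : divFree n → Prop} (X : divFree n)
    (hm : ∀ u r h, p (divFree.D u r h)) (h0 : p 0) (ha : ∀ X Y, p X → p Y → p (X + Y))
    (hs : ∀ (c : ℂ) X, p X → p (c • X)) : p X := by
  obtain ⟨X, hX⟩ := X
  change X ∈ Submodule.span ℂ (divFreeGen n) at hX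
  induction hX using Submodule.span_induction with
  | mem X h => obtain ⟨u, r, hu, rfl⟩ := h; exact hm u r hu
  | zero => exact h0
  | add X Y _ _ h h' => exact ha _ _ h h'
  | smul c X _ h => exact hs c _ h

/-- The Weyl algebra `𝒦_n` over `A_n`: the algebra of differential operators on `A_n` generated by
the multiplications by the monomials `x^r`, `r ∈ ℤⁿ`, and by `∂₁, …, ∂ₙ`. -/
def weyl (n : ℕ) : Subalgebra ℂ (Module.End ℂ (Laurent n)) :=
  Algebra.adjoin ℂ
    ((Set.range fun r : Fin n → ℤ => LinearMap.mulLeft ℂ (mono r)) ∪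
      Set.range fun i : Fin n => ((euler i : Derivation ℂ (Laurent n) (Laurent n)) :
        Laurent n →ₗ[ℂ] Laurent n))

/-- The element `x^r` of `𝒦_n`. -/
def weyl.x {n : ℕ} (r : Fin n → ℤ) : weyl n :=
  ⟨LinearMap.mulLeft ℂ (mono r), Algebra.subset_adjoin (Or.inl ⟨r, rfl⟩)⟩

/-- The element `∂ᵢ` of `𝒦_n`. -/
def weyl.d {n : ℕ} (i : Fin n) : weyl n :=
  ⟨(euler i : Laurent n →ₗ[ℂ] Laurent n), Algebra.subset_adjoin (Or.inr ⟨i, rfl⟩)⟩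

theorem coe_vf {n : ℕ} (u : Fin n → ℂ) (r : Fin n → ℤ) :
    ((vf u r : Derivation ℂ (Laurent n) (Laurent n)) : Laurent n →ₗ[ℂ] Laurent n) =
      ((weyl.x r * ∑ i, u i • weyl.d i : weyl n) : Module.End ℂ (Laurent n)) := by
  refine LinearMap.ext fun f => ?_
  simp [vf, weyl.x, weyl.d, derivation_sum_apply, LinearMap.sum_apply, Finset.mul_sum]

theorem mem_weyl {n : ℕ} (X : divFree n) :
    ((X : Derivation ℂ (Laurent n) (Laurent n)) : Laurent n →ₗ[ℂ] Laurent n) ∈ weyl n := by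
  induction X using divFree_induction with
  | hm u r h => rw [divFree.D, coe_vf]; exact Subtype.property _
  | h0 => simp
  | ha X Y hX hY => simpa using add_mem hX hY
  | hs c X hX => simpa using Subalgebra.smul_mem _ hX c

/-- The inclusion `𝕊_n ⊆ 𝒦_n` of vector fields into differential operators. -/
def toWeyl (n : ℕ) : divFree n →ₗ[ℂ] weyl n where
  toFun X := ⟨_, mem_weyl X⟩
  map_add' _ _ := by ext1; simp
  map_smul' _ _ := by ext1; simp

theorem toWeyl_D {n : ℕ} (u : Fin n → ℂ) (r : Fin n → ℤ) (h : pair u r = 0) :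
    toWeyl n (divFree.D u r h) = weyl.x r * ∑ i, u i • weyl.d i :=
  Subtype.ext (coe_vf u r)

theorem toWeyl_lie {n : ℕ} (X Y : divFree n) :
    toWeyl n ⁅X, Y⁆ + toWeyl n Y * toWeyl n X = toWeyl n X * toWeyl n Y := by
  ext1
  refine LinearMap.ext fun f => ?_
  exact sub_add_cancel (X.1 (Y.1 f)) (Y.1 (X.1 f))

theorem x_mul_x {n : ℕ} (r s : Fin n → ℤ) : (weyl.x r * weyl.x s : weyl n) = weyl.x (r + s) := by
  ext1
  simp [weyl.x, ← mono_mul, LinearMap.mulLeft_mul, Module.End.mul_eq_comp]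

theorem toWeyl_mul_x {n : ℕ} (u : Fin n → ℂ) (r s : Fin n → ℤ) (h : pair u r = 0) :
    toWeyl n (divFree.D u r h) * weyl.x s =
      weyl.x s * toWeyl n (divFree.D u r h) + pair u s • weyl.x (r + s) := by
  ext1
  refine LinearMap.ext fun f => ?_
  simp [toWeyl, divFree.D, weyl.x, vf_mono, mul_comm, add_comm]

/-- `𝔰𝔩_n(ℂ)`. -/
abbrev sl (n : ℕ) := LieAlgebra.SpecialLinear.sl (Fin n) ℂ

/-- For `(u | r) = 0`, the traceless matrix `r uᵀ`. -/
def outer {n : ℕ} (u : Fin n → ℂ) (r : Fin n → ℤ) (h : pair u r = 0) : sl n :=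
  ⟨Matrix.vecMulVec (fun i => (r i : ℂ)) u, by
    change Matrix.trace (Matrix.vecMulVec (fun i => (r i : ℂ)) u) = 0
    simpa [Matrix.trace, Matrix.vecMulVec_apply, pair, mul_comm] using h⟩

/-- The coefficient of `x^r` in `x_j⁻¹ X(x_j)`. As `X = ∑_j x_j⁻¹ X(x_j) ∂_j`, it is the coefficient
of `x^r ∂_j` in `X`. -/
def vfCoeff {n : ℕ} (r : Fin n → ℤ) (j : Fin n) : divFree n →ₗ[ℂ] ℂ where
  toFun X := (mono (-Pi.single j 1) * X.1 (mono (Pi.single j 1))).coeff r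
  map_add' X Y := by simp [mul_add]
  map_smul' c X := by simp

theorem vfCoeff_D {n : ℕ} (u : Fin n → ℂ) (s r : Fin n → ℤ) (h : pair u s = 0) (j : Fin n) :
    vfCoeff r j (divFree.D u s h) = if s = r then u j else 0 := by
  have h1 : pair u (Pi.single j 1) = u j := by
    simp [pair, Pi.single_apply, apply_ite (Int.cast : ℤ → ℂ)]
  have h2 : -Pi.single j 1 + (s + Pi.single j 1) = s := by abel
  simp only [vfCoeff, LinearMap.coe_mk, AddHom.coe_mk, divFree.D, vf_mono, mul_smul_comm, mono_mul,
    h1, h2]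
  simp [mono, AddMonoidAlgebra.coeff_single, Finsupp.single_apply]

theorem vfCoeff_div {n : ℕ} (r : Fin n → ℤ) (X : divFree n) :
    ∑ j, (r j : ℂ) * vfCoeff r j X = 0 := by
  induction X using divFree_induction with
  | hm u s h =>
    simp only [vfCoeff_D]
    by_cases hs : s = r
    · subst hs
      simpa [pair, mul_comm] using h
    · simp [hs]
  | h0 => simp
  | ha X Y hX hY => simp [mul_add, Finset.sum_add_distrib, hX, hY]
  | hs c X hX =>
    simp only [map_smul, smul_eq_mul, mul_left_comm _ c, ← Finset.mul_sum, hX, mul_zero]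

/-- Writing `X ∈ 𝕊_n` as `∑_r D(u^{(r)}, r)`, this is the finitely supported family of the traceless
matrices `r (u^{(r)})ᵀ`. -/
def symbol (n : ℕ) : divFree n →ₗ[ℂ] ((Fin n → ℤ) →₀ sl n) where
  toFun X := Finsupp.onFinset
    (Finset.univ.biUnion fun j : Fin n =>
      (mono (-Pi.single j 1) * X.1 (mono (Pi.single j 1))).coeff.support)
    (fun r => outer (fun j => vfCoeff r j X) r (by
      simpa [pair, mul_comm] using vfCoeff_div r X))
    (by
      intro r hr
      by_contra hn
      apply hr
      simp only [Finset.mem_biUnion, Finset.mem_univ, true_and, not_exists,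
        Finsupp.notMem_support_iff] at hn
      ext i j
      have : vfCoeff r j X = 0 := hn j
      simp [outer, Matrix.vecMulVec_apply, this])
  map_add' X Y := by
    ext r i j
    simp [outer, Matrix.vecMulVec_apply, mul_add]
  map_smul' c X := by
    ext r i j
    simp [outer, Matrix.vecMulVec_apply, mul_left_comm]

theorem symbol_D {n : ℕ} (u : Fin n → ℂ) (r : Fin n → ℤ) (h : pair u r = 0) :
    symbol n (divFree.D u r h) = Finsupp.single r (outer u r h) := by
  ext s i j
  by_cases hs : r = s
  · subst hs
    simp [symbol, outer, Matrix.vecMulVec_apply, vfCoeff_D]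
  · simp [symbol, outer, Matrix.vecMulVec_apply, vfCoeff_D, hs]

section tensorModule

/-- The underlying space `P ⊗ V` of `F(P, V)`. -/
def TensorModule (_n : ℕ) (P V : Type*) [AddCommGroup P] [Module ℂ P] [AddCommGroup V]
    [Module ℂ V] : Type _ :=
  P ⊗[ℂ] V

instance (n : ℕ) (P V : Type*) [AddCommGroup P] [Module ℂ P] [AddCommGroup V] [Module ℂ V] :
    AddCommGroup (TensorModule n P V) :=
  inferInstanceAs (AddCommGroup (P ⊗[ℂ] V))

instance (n : ℕ) (P V : Type*) [AddCommGroup P] [Module ℂ P] [AddCommGroup V] [Module ℂ V] :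
    Module ℂ (TensorModule n P V) :=
  inferInstanceAs (Module ℂ (P ⊗[ℂ] V))

variable {n : ℕ} (P V : Type*) [AddCommGroup P] [Module ℂ P] [Module (weyl n) P]
  [IsScalarTower ℂ (weyl n) P] [AddCommGroup V] [Module ℂ V]

/-- The bilinear map `(a, Y) ↦ (z ⊗ y ↦ a z ⊗ Y y)` for `a ∈ 𝒦_n` and an operator `Y` on `V`. -/
def tensorOp : weyl n →ₗ[ℂ] Module.End ℂ V →ₗ[ℂ] Module.End ℂ (P ⊗[ℂ] V) :=
  (TensorProduct.mapBilinear (RingHom.id ℂ) P V P V).comp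
    (Algebra.lsmul ℂ ℂ P : weyl n →ₐ[ℂ] Module.End ℂ P).toLinearMap

theorem tensorOp_tmul (a : weyl n) (Y : Module.End ℂ V) (z : P) (y : V) :
    tensorOp P V a Y (z ⊗ₜ y) = (a • z) ⊗ₜ[ℂ] Y y := by
  simp [tensorOp]

variable [LieRingModule (sl n) V] [LieModule ℂ (sl n) V]

variable (n) in
/-- The action of `𝔰𝔩_n` on `V`, as a linear map. -/
def slOp : sl n →ₗ[ℂ] Module.End ℂ V :=
  LinearMap.mk₂ ℂ (fun (A : sl n) (y : V) => ⁅A, y⁆) add_lie smul_lie lie_add (fun c A y => lie_smul c A y)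

/-- The action of `𝕊_n` on `F(P, V)`: an element `X = ∑_r D(u^{(r)}, r)` acts by
`X(z ⊗ y) = X z ⊗ y + ∑_r x^r z ⊗ (r (u^{(r)})ᵀ) y`. -/
def act : divFree n →ₗ[ℂ] Module.End ℂ (P ⊗[ℂ] V) :=
  ((tensorOp P V).flip 1).comp (toWeyl n) +
    (Finsupp.lsum ℂ fun r : Fin n → ℤ =>
      (tensorOp P V (weyl.x r)).comp (slOp n V)).comp (symbol n)

theorem act_D (u : Fin n → ℂ) (r : Fin n → ℤ) (h : pair u r = 0) (z : P) (y : V) :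
    act P V (divFree.D u r h) (z ⊗ₜ y) =
      (toWeyl n (divFree.D u r h) • z) ⊗ₜ[ℂ] y + (weyl.x r • z) ⊗ₜ[ℂ] ⁅outer u r h, y⁆ := by
  simp [act, symbol_D, tensorOp_tmul, slOp]

theorem act_lie (X Y : divFree n) (t : P ⊗[ℂ] V) :
    act P V ⁅X, Y⁆ t = act P V X (act P V Y t) - act P V Y (act P V X t) := by
  induction X using divFree_induction with
  | h0 => simp
  | ha X X' h h' => simp only [add_lie, map_add, LinearMap.add_apply, h, h']; abel
  | hs c X h => simp only [smul_lie, map_smul, LinearMap.smul_apply, h, smul_sub]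
  | hm u r hu =>
  induction Y using divFree_induction with
  | h0 => simp
  | ha X X' h h' => simp only [lie_add, map_add, LinearMap.add_apply, h, h']; abel
  | hs c X h => simp only [lie_smul, map_smul, LinearMap.smul_apply, h, smul_sub]
  | hm v s hv =>
  induction t using TensorProduct.induction_on with
  | zero => simp
  | add t t' h h' => simp only [map_add, h, h']; abel
  | tmul z y =>
  have hw : pair (pair u s • v - pair v r • u) (r + s) = 0 := by
    simp only [pair_sub_left, pair_smul_left, pair_add_right, hu, hv]
    ring
  have hb : ⁅divFree.D u r hu, divFree.D v s hv⁆ = divFree.D _ (r + s) hw :=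
    Subtype.ext (vf_lie u v r s)
  have ho : outer _ (r + s) hw =
      ⁅outer u r hu, outer v s hv⁆ + pair u s • outer v s hv - pair v r • outer u r hu := by
    refine Subtype.ext ?_
    have e0 := LieAlgebra.SpecialLinear.sl_bracket (Fin n) ℂ (outer u r hu) (outer v s hv)
    change _ = (⁅outer u r hu, outer v s hv⁆ : sl n).1 + pair u s • (outer v s hv).1 -
      pair v r • (outer u r hu).1
    rw [e0]
    ext i j
    have e1 : ∑ k, (r i : ℂ) * u k * ((s k : ℂ) * v j) = (r i : ℂ) * v j * pair u s := by
      rw [pair, Finset.mul_sum]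
      exact Finset.sum_congr rfl fun k _ => by ring
    have e2 : ∑ k, (s i : ℂ) * v k * ((r k : ℂ) * u j) = (s i : ℂ) * u j * pair v r := by
      rw [pair, Finset.mul_sum]
      exact Finset.sum_congr rfl fun k _ => by ring
    simp [outer, Matrix.mul_apply, Matrix.vecMulVec_apply,
      e1, e2]
    ring
  have hc := toWeyl_lie (divFree.D u r hu) (divFree.D v s hv)
  have c1 := toWeyl_mul_x u r s hu
  have c2 := toWeyl_mul_x v s r hv
  have hz := eq_sub_of_add_eq ((add_smul _ _ z).symm.trans (congrArg (· • z) hc))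
  rw [hb, act_D, ← hb, hz, ho]
  simp only [act_D, map_add, ← mul_smul, c1, c2, x_mul_x, add_smul, lie_lie, sub_lie,
    add_lie, TensorProduct.sub_tmul, TensorProduct.add_tmul, TensorProduct.tmul_add,
    TensorProduct.tmul_sub, smul_lie, TensorProduct.tmul_smul, smul_assoc, add_comm s r]
  simp only [← TensorProduct.smul_tmul']
  abel

instance : LieRingModule (divFree n) (TensorModule n P V) where
  bracket X t := act P V X t
  add_lie X Y t := by
    change act P V (X + Y) t = act P V X t + act P V Y t
    exact LinearMap.congr_fun (map_add (act P V) X Y) t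
  lie_add X t t' := map_add (act P V X) t t'
  leibniz_lie X Y t := by
    change act P V X (act P V Y t) = act P V ⁅X, Y⁆ t + act P V Y (act P V X t)
    exact (sub_eq_iff_eq_add.mp (act_lie P V X Y t).symm)

instance : LieModule ℂ (divFree n) (TensorModule n P V) where
  smul_lie c X t := by
    change act P V (c • X) t = c • act P V X t
    exact LinearMap.congr_fun (map_smul (act P V) c X) t
  lie_smul c X t := map_smul (act P V X) c t

/-- `D(u, r)(z ⊗ y) = D(u, r) z ⊗ y + x^r z ⊗ (r uᵀ) y`. -/
theorem lie_tmul (u : Fin n → ℂ) (r : Fin n → ℤ) (h : pair u r = 0) (z : P) (y : V) :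
    ⁅divFree.D u r h, (show TensorModule n P V from z ⊗ₜ[ℂ] y)⁆ =
      (show TensorModule n P V from ((weyl.x r * ∑ i, u i • weyl.d i : weyl n) • z) ⊗ₜ[ℂ] y +
        (weyl.x r • z) ⊗ₜ[ℂ] ⁅outer u r h, y⁆) := by
  rw [← toWeyl_D u r h]
  exact act_D P V u r h z y

end tensorModule

section exterior

/-- The exterior power `⋀^k(ℂⁿ)`. -/
def ExtPow (n k : ℕ) : Type := ⋀[ℂ]^k (Fin n → ℂ)

instance (n k : ℕ) : AddCommGroup (ExtPow n k) := inferInstanceAs (AddCommGroup (⋀[ℂ]^k (Fin n → ℂ)))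

instance (n k : ℕ) : Module ℂ (ExtPow n k) := inferInstanceAs (Module ℂ (⋀[ℂ]^k (Fin n → ℂ)))

/-- The alternating map `(v₁, …, v_k) ↦ v₁ ∧ ⋯ ∧ v_k`. -/
def wedge (n k : ℕ) : (Fin n → ℂ) [⋀^Fin k]→ₗ[ℂ] ExtPow n k := exteriorPower.ιMulti ℂ k

theorem extPow_hom_ext {n k : ℕ} {f g : ExtPow n k →ₗ[ℂ] ExtPow n k}
    (h : ∀ v, f (wedge n k v) = g (wedge n k v)) : f = g :=
  exteriorPower.linearMap_ext (AlternatingMap.ext h)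

/-- The multilinear map `(v₁, …, v_k) ↦ ∑ i, v₁ ∧ ⋯ ∧ X vᵢ ∧ ⋯ ∧ v_k`. -/
def wedgeDer (n k : ℕ) (X : Matrix (Fin n) (Fin n) ℂ) :
    MultilinearMap ℂ (fun _ : Fin k => Fin n → ℂ) (ExtPow n k) :=
  ∑ i : Fin k, (wedge n k).toMultilinearMap.compLinearMap
    fun j => if j = i then X.mulVecLin else LinearMap.id

theorem wedgeDer_apply {n k : ℕ} (X : Matrix (Fin n) (Fin n) ℂ) (v : Fin k → Fin n → ℂ) :
    wedgeDer n k X v = ∑ i, wedge n k (Function.update v i (X.mulVec (v i))) := by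
  simp only [wedgeDer, sum_apply, MultilinearMap.compLinearMap_apply]
  refine Finset.sum_congr rfl fun i _ => ?_
  refine congrArg (wedge n k) (funext fun j => ?_)
  by_cases h : j = i
  · subst h; simp
  · simp [h]

theorem wedgeDer_eq_zero {n k : ℕ} (X : Matrix (Fin n) (Fin n) ℂ) (v : Fin k → Fin n → ℂ)
    (i j : Fin k) (h : v i = v j) (hij : i ≠ j) : wedgeDer n k X v = 0 := by
  rw [wedgeDer_apply, ← Finset.add_sum_erase _ _ (Finset.mem_univ i),
    ← Finset.add_sum_erase _ _ (Finset.mem_erase.2 ⟨hij.symm, Finset.mem_univ j⟩), ← add_assoc]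
  have h1 : Function.update v j (X.mulVec (v j)) =
      Function.update v i (X.mulVec (v i)) ∘ Equiv.swap i j := by
    funext l
    by_cases hi : l = i
    · subst hi; simp [Function.update_of_ne hij, Function.update_of_ne hij.symm, h]
    · by_cases hj : l = j
      · subst hj; simp [h]
      · simp [Equiv.swap_apply_of_ne_of_ne hi hj, hi, hj]
  rw [h1, AlternatingMap.map_add_swap _ _ hij, zero_add]
  refine Finset.sum_eq_zero fun l hl => ?_
  have hlj : l ≠ j := (Finset.mem_erase.1 hl).1
  have hli : l ≠ i := (Finset.mem_erase.1 (Finset.mem_erase.1 hl).2).1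
  refine (wedge n k).map_eq_zero_of_eq _ (i := i) (j := j) ?_ hij
  rw [Function.update_of_ne hli.symm, Function.update_of_ne hlj.symm, h]

/-- The operator of a matrix `X` on `⋀^k(ℂⁿ)`. -/
def extOp (n k : ℕ) (X : Matrix (Fin n) (Fin n) ℂ) : ExtPow n k →ₗ[ℂ] ExtPow n k :=
  exteriorPower.alternatingMapLinearEquiv
    { wedgeDer n k X with map_eq_zero_of_eq' := wedgeDer_eq_zero X }

theorem extOp_wedge {n k : ℕ} (X : Matrix (Fin n) (Fin n) ℂ) (v : Fin k → Fin n → ℂ) :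
    extOp n k X (wedge n k v) = ∑ i, wedge n k (Function.update v i (X.mulVec (v i))) :=
  (exteriorPower.alternatingMapLinearEquiv_apply_ιMulti _ v).trans (wedgeDer_apply X v)

theorem extOp_add {n k : ℕ} (X Y : Matrix (Fin n) (Fin n) ℂ) :
    extOp n k (X + Y) = extOp n k X + extOp n k Y := by
  refine extPow_hom_ext fun v => ?_
  simp only [LinearMap.add_apply, extOp_wedge, Matrix.add_mulVec, AlternatingMap.map_update_add,
    Finset.sum_add_distrib]

theorem extOp_smul {n k : ℕ} (c : ℂ) (X : Matrix (Fin n) (Fin n) ℂ) :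
    extOp n k (c • X) = c • extOp n k X := by
  refine extPow_hom_ext fun v => ?_
  simp only [LinearMap.smul_apply, extOp_wedge, Matrix.smul_mulVec, AlternatingMap.map_update_smul,
    Finset.smul_sum]

theorem extOp_commutator {n k : ℕ} (X Y : Matrix (Fin n) (Fin n) ℂ) :
    extOp n k (X * Y - Y * X) = extOp n k X ∘ₗ extOp n k Y - extOp n k Y ∘ₗ extOp n k X := by
  refine extPow_hom_ext fun v => ?_
  have key : ∀ i j : Fin k, ∀ A B : Matrix (Fin n) (Fin n) ℂ, j ≠ i →
      Function.update (Function.update v i (B.mulVec (v i))) j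
          (A.mulVec (Function.update v i (B.mulVec (v i)) j)) =
        Function.update (Function.update v j (A.mulVec (v j))) i
          (B.mulVec (Function.update v j (A.mulVec (v j)) i)) := by
    intro i j A B hij
    rw [Function.update_of_ne hij, Function.update_of_ne hij.symm, Function.update_comm hij.symm]
  simp only [LinearMap.sub_apply, LinearMap.comp_apply, extOp_wedge, map_sum]
  rw [Finset.sum_comm (f := fun i j => wedge n k (Function.update
    (Function.update v i (X.mulVec (v i))) j
      (Y.mulVec (Function.update v i (X.mulVec (v i)) j)))), ← Finset.sum_sub_distrib]
  refine Finset.sum_congr rfl fun i _ => ?_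
  rw [← Finset.sum_sub_distrib, Finset.sum_eq_single i]
  · simp only [Function.update_self, Function.update_idem, Matrix.mulVec_mulVec, Matrix.sub_mulVec,
      AlternatingMap.map_update_sub]
  · intro j _ hj
    rw [key i j X Y hj, sub_self]
  · simp

/-- `X(v₁ ∧ ⋯ ∧ v_k) = ∑ i, v₁ ∧ ⋯ ∧ X vᵢ ∧ ⋯ ∧ v_k` for `X ∈ 𝔰𝔩_n`. For `0 ≤ k ≤ n - 1` this is the
module `V(δ_k)`. -/
instance (n k : ℕ) : LieRingModule (sl n) (ExtPow n k) where
  bracket X w := extOp n k X.1 w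
  add_lie X Y w := LinearMap.congr_fun (extOp_add X.1 Y.1) w
  lie_add X w w' := map_add (extOp n k X.1) w w'
  leibniz_lie X Y w := by
    have h := LinearMap.congr_fun (extOp_commutator (k := k) X.1 Y.1) w
    rw [← LieAlgebra.SpecialLinear.sl_bracket] at h
    exact sub_eq_iff_eq_add.mp h.symm

instance (n k : ℕ) : LieModule ℂ (sl n) (ExtPow n k) where
  smul_lie c X w := LinearMap.congr_fun (extOp_smul c X.1) w
  lie_smul c X w := map_smul (extOp n k X.1) c w

theorem lie_wedge {n k : ℕ} (X : sl n) (v : Fin k → Fin n → ℂ) :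
    ⁅X, wedge n k v⁆ = ∑ i, wedge n k (Function.update v i (X.1.mulVec (v i))) :=
  extOp_wedge X.1 v

end exterior

end TorusVF

end

/-!
The proof recovers the action of `𝒦_n ⊗ U(𝔰𝔩_n)` on `F(P, V) = P ⊗ V` from that of `𝕊_n`.

For `i ≠ j`, `r ∈ ℤⁿ` and `m ∈ ℕ` the product of `D((r_i - m) e_j - r_j e_i, r - m e_i)` and
`D(e_j, m e_i)` acts on `P ⊗ V` as a cubic polynomial in `m` with leading coefficient
`x^r ⊗ E_ij²` (`exists_act_mul_act`). A third difference in `m` shows that an `𝕊_n`-homomorphism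
`φ : P ⊗ V → P' ⊗ V'` intertwines `x^r ⊗ E_ij²`, hence also `a ⊗ E_ij²` for every `a ∈ 𝒦_n`
(`sq_mem_weylIntertwined`). The elements `Z` of `U(𝔰𝔩_n)` for which `φ` intertwines all `a ⊗ Z` are
a left ideal `J` (`slPair_mul_mem`). If some `E_ij²` acts on the irreducible module `V` by a nonzero
operator, then `J V = V`, and it follows that `φ` is a homomorphism of `𝒦_n ⊗ U(𝔰𝔩_n)`-modules
(`one_mem_weylIntertwined`). Contracting `φ` with linear forms on `V'` and on `P'` gives nonzero
homomorphisms `P → P'` and `V → V'`, which are isomorphisms by Schur's lemma.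

It remains to see that an irreducible `V` on which every `E_ij` squares to zero is some `⋀^k(ℂⁿ)`
with `k < n` (`SquareZero.exists_equiv_extPow`). On such a module the `𝔰𝔩₂`-relations force every
coroot `h` to satisfy `h³ = h`, without any finiteness assumption. A common eigenvector of the
coroots therefore exists, and its weight is the indicator function of a proper subset `S` of the
indices; it is a highest vector for the maximal parabolic subalgebra belonging to `S`
(`SquareZero.exists_isHighest`). The same holds for submodules of `⋀^k(ℂⁿ)`, which shows that this
module is irreducible, and irreducible modules with highest vectors of the same type are isomorphic
(`IsHighest.nonempty_equiv`).
-/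

noncomputable section

namespace TorusVF

/-! ### Root vectors and coroots of `𝔰𝔩_n` -/

/-- The matrix unit `E_ij`, `i ≠ j`, as an element of `𝔰𝔩_n`. -/
def rootVec {n : ℕ} (i j : Fin n) (h : i ≠ j) : sl n :=
  LieAlgebra.SpecialLinear.single i j h 1

/-- The diagonal matrix `E_ii - E_jj` as an element of `𝔰𝔩_n`. -/
def coroot {n : ℕ} (i j : Fin n) : sl n :=
  LieAlgebra.SpecialLinear.singleSubSingle i j 1

theorem rootVec_val {n : ℕ} (i j : Fin n) (h : i ≠ j) :
    (rootVec i j h).1 = Matrix.single i j 1 := rfl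

theorem coroot_val {n : ℕ} (i j : Fin n) :
    (coroot i j).1 = Matrix.single i i 1 - Matrix.single j j 1 := rfl

theorem sl_lie_val {n : ℕ} (A B : sl n) : ⁅A, B⁆.1 = A.1 * B.1 - B.1 * A.1 :=
  LieAlgebra.SpecialLinear.sl_bracket (Fin n) ℂ A B

theorem lie_rootVec_rootVec {n : ℕ} (i j : Fin n) (h : i ≠ j) :
    ⁅rootVec i j h, rootVec j i h.symm⁆ = coroot i j := by
  refine Subtype.ext ?_
  rw [sl_lie_val, rootVec_val, rootVec_val, coroot_val]
  simp

theorem lie_coroot_rootVec {n : ℕ} (i j : Fin n) (h : i ≠ j) :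
    ⁅coroot i j, rootVec i j h⁆ = (2 : ℂ) • rootVec i j h := by
  refine Subtype.ext ?_
  rw [sl_lie_val, coroot_val]
  change _ = (2 : ℂ) • (rootVec i j h).1
  rw [rootVec_val]
  simp [sub_mul, mul_sub, h.symm, two_smul]

theorem lie_coroot_coroot {n : ℕ} (i j k l : Fin n) : ⁅coroot i j, coroot k l⁆ = 0 := by
  refine Subtype.ext ?_
  rw [sl_lie_val, coroot_val, coroot_val]
  change _ = (0 : Matrix (Fin n) (Fin n) ℂ)
  have hd : ∀ a b : Fin n, Matrix.single a a (1 : ℂ) * Matrix.single b b 1 =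
      Matrix.single b b 1 * Matrix.single a a 1 := by
    intro a b
    by_cases hab : a = b
    · subst hab; rfl
    · simp [hab, Ne.symm hab]
  simp only [sub_mul, mul_sub, hd i, hd j]
  abel

theorem coroot_sub {n : ℕ} (i j o : Fin n) : coroot i o - coroot j o = coroot i j := by
  refine Subtype.ext ?_
  change (coroot i o).1 - (coroot j o).1 = _
  simp only [coroot_val, sub_sub_sub_cancel_right]

/-- The matrix `E_ij` for `i ≠ j`, and `E_ii - E_oo` for `i = j`. -/
def tracelessUnit {n : ℕ} (o i j : Fin n) : sl n :=
  ⟨Matrix.single i j 1 - if i = j then Matrix.single o o 1 else 0, by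
    change Matrix.trace (Matrix.single i j 1 - if i = j then Matrix.single o o 1 else 0 :
      Matrix (Fin n) (Fin n) ℂ) = 0
    by_cases h : i = j
    · subst h; simp
    · simp [h]⟩

theorem tracelessUnit_of_ne {n : ℕ} (o i j : Fin n) (h : i ≠ j) :
    tracelessUnit o i j = rootVec i j h :=
  Subtype.ext (by simp [tracelessUnit, rootVec_val, h])

theorem tracelessUnit_self {n : ℕ} (o i : Fin n) : tracelessUnit o i i = coroot i o :=
  Subtype.ext (by simp [tracelessUnit, coroot_val])

theorem sl_eq_sum {n : ℕ} (A : sl n) (o : Fin n) :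
    A = ∑ i, ∑ j, A.1 i j • tracelessUnit o i j := by
  have htr : ∑ i, A.1 i i = 0 := A.2
  have hval : ∀ i j, ((A.1 i j • tracelessUnit o i j : sl n) : Matrix (Fin n) (Fin n) ℂ) =
      A.1 i j • Matrix.single i j 1 - if i = j then A.1 i i • Matrix.single o o 1 else 0 := by
    intro i j
    change A.1 i j • (tracelessUnit o i j).1 = _
    rw [tracelessUnit, smul_sub]
    by_cases h : i = j
    · subst h; simp
    · simp [h]
  refine Subtype.ext ?_
  simp only [AddSubmonoidClass.coe_finsetSum, hval, Finset.sum_sub_distrib, Finset.sum_ite_eq,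
    Finset.mem_univ, if_true, ← Finset.sum_smul, htr, zero_smul, sub_zero]
  conv_lhs => rw [Matrix.matrix_eq_sum_single A.1]
  simp [Matrix.smul_single]

/-! ### Square-zero modules and their weight vectors -/

section Module

variable {n : ℕ} (M : Type*) [AddCommGroup M] [Module ℂ M] [LieRingModule (sl n) M]
  [LieModule ℂ (sl n) M]

/-- Every root vector of `𝔰𝔩_n` acts on `M` with square zero. -/
def SquareZero : Prop :=
  ∀ (i j : Fin n) (h : i ≠ j) (m : M), ⁅rootVec i j h, ⁅rootVec i j h, m⁆⁆ = 0

variable {M}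

/-- The vector `v` has weight `∑_{i ∈ S} εᵢ` and is annihilated by the root vectors `E_ij`, except
possibly those with `i ∉ S` and `j ∈ S`: the maximal parabolic subalgebra of matrices with zero
block `Sᶜ × S` acts on `v` through its character `A ↦ ∑_{i ∈ S} A_ii`. -/
def IsHighest (S : Finset (Fin n)) (v : M) : Prop :=
  ∀ A : sl n, (∀ i, i ∉ S → ∀ j, j ∈ S → A.1 i j = 0) → ⁅A, v⁆ = (∑ i ∈ S, A.1 i i) • v

/-- From `e² = 0` one gets `e h + h e = 0` by bracketing with `f`; together with `[h, e] = 2 e` this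
gives `e h = -e`. -/
theorem SquareZero.rootVec_coroot (hM : SquareZero (n := n) M) (i j : Fin n) (h : i ≠ j) (m : M) :
    ⁅rootVec i j h, ⁅coroot i j, m⁆⁆ = -⁅rootVec i j h, m⁆ := by
  set e := rootVec i j h
  set f := rootVec j i h.symm
  have h1 : ∀ m : M, ⁅coroot i j, m⁆ = ⁅e, ⁅f, m⁆⁆ - ⁅f, ⁅e, m⁆⁆ := fun m => by
    rw [← lie_rootVec_rootVec i j h, lie_lie]
  have h2 : ∀ m : M, ⁅coroot i j, ⁅e, m⁆⁆ = ⁅e, ⁅coroot i j, m⁆⁆ + (2 : ℂ) • ⁅e, m⁆ := fun m => by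
    rw [← smul_lie, ← lie_coroot_rootVec i j h, lie_lie]; abel
  have h3 : ⁅e, ⁅coroot i j, m⁆⁆ + ⁅coroot i j, ⁅e, m⁆⁆ = 0 := by
    rw [h1, h1, lie_sub, hM i j h, hM i j h, lie_zero]; abel
  rw [h2] at h3
  have h4 : (2 : ℂ) • (⁅e, ⁅coroot i j, m⁆⁆ + ⁅e, m⁆) = 0 := by
    rw [← h3, smul_add, two_smul ℂ ⁅e, ⁅coroot i j, m⁆⁆]; abel
  exact eq_neg_of_add_eq_zero_left ((smul_eq_zero_iff_right two_ne_zero).1 h4)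

/-- A coroot `h` satisfies `h³ = h` on a square-zero module. -/
theorem SquareZero.coroot_cube (hM : SquareZero (n := n) M) (i j : Fin n) (m : M) :
    ⁅coroot i j, ⁅coroot i j, ⁅coroot i j, m⁆⁆⁆ = ⁅coroot i j, m⁆ := by
  by_cases h : i = j
  · subst h
    have : coroot i i = 0 := Subtype.ext (by rw [coroot_val, sub_self]; rfl)
    simp [this]
  set e := rootVec i j h
  set f := rootVec j i (Ne.symm h)
  have hf : ∀ m : M, ⁅coroot i j, ⁅f, m⁆⁆ = -⁅f, m⁆ := by
    intro m
    have h1 := hM.rootVec_coroot j i (Ne.symm h) m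
    have h2 : coroot i j = -coroot j i :=
      Subtype.ext (by
        change _ = -(coroot j i).1
        rw [coroot_val, coroot_val, neg_sub])
    have h3 : ⁅coroot j i, ⁅f, m⁆⁆ = ⁅f, ⁅coroot j i, m⁆⁆ + (2 : ℂ) • ⁅f, m⁆ := by
      rw [← smul_lie, ← lie_coroot_rootVec j i (Ne.symm h), lie_lie]; abel
    rw [h2, neg_lie, h3, h1, two_smul]; abel
  have he := hM.rootVec_coroot i j h
  have h1 : ∀ m : M, ⁅coroot i j, m⁆ = ⁅e, ⁅f, m⁆⁆ - ⁅f, ⁅e, m⁆⁆ := fun m => by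
    rw [← lie_rootVec_rootVec i j h, lie_lie]
  -- Bracketing `e h + e = 0` with `f` gives `h² - h = 2 f e`.
  have h5 : ⁅coroot i j, ⁅coroot i j, m⁆⁆ - ⁅coroot i j, m⁆ = (2 : ℂ) • ⁅f, ⁅e, m⁆⁆ := by
    have a1 := h1 ⁅coroot i j, m⁆
    have a2 : ⁅f, ⁅coroot i j, m⁆⁆ = ⁅f, m⁆ := by
      have h2 : coroot i j = -coroot j i :=
        Subtype.ext (by
          change _ = -(coroot j i).1
          rw [coroot_val, coroot_val, neg_sub])
      rw [h2, neg_lie, lie_neg, hM.rootVec_coroot j i (Ne.symm h), neg_neg]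
    rw [a1, he, a2, h1 m, lie_neg, two_smul]
    abel
  have h6 := congrArg (fun x => ⁅coroot i j, x⁆ + x) h5
  simp only [lie_sub, lie_smul, hf, smul_neg, neg_add_cancel] at h6
  rw [← sub_eq_zero, ← h6]
  abel

/-- The three eigenvalues `0, 1, -1` of coroots allow common eigenvectors to be found by successive
projections. -/
theorem SquareZero.exists_eigenvector (hM : SquareZero (n := n) M) [Nontrivial M] (o : Fin n) :
    ∃ (v : M) (c : Fin n → ℂ), v ≠ 0 ∧ ∀ i, ⁅coroot i o, v⁆ = c i • v := by
  suffices h : ∀ s : Finset (Fin n), ∃ (v : M) (c : Fin n → ℂ), v ≠ 0 ∧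
      ∀ i ∈ s, ⁅coroot i o, v⁆ = c i • v by
    obtain ⟨v, c, hv, h⟩ := h Finset.univ
    exact ⟨v, c, hv, fun i => h i (Finset.mem_univ i)⟩
  intro s
  induction s using Finset.induction_on with
  | empty =>
    obtain ⟨v, hv⟩ := exists_ne (0 : M)
    exact ⟨v, 0, hv, by simp⟩
  | insert a s ha ih =>
    obtain ⟨v, c, hv, hc⟩ := ih
    have hcomm : ∀ (i : Fin n) (m : M), ⁅coroot i o, ⁅coroot a o, m⁆⁆ =
        ⁅coroot a o, ⁅coroot i o, m⁆⁆ := fun i m => by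
      rw [leibniz_lie, lie_coroot_coroot, zero_lie, zero_add]
    suffices ∃ (w : M) (d : ℂ), w ≠ 0 ∧ (∀ i ∈ s, ⁅coroot i o, w⁆ = c i • w) ∧
        ⁅coroot a o, w⁆ = d • w by
      obtain ⟨w, d, hw, h1, h2⟩ := this
      refine ⟨w, Function.update c a d, hw, fun i hi => ?_⟩
      by_cases hia : i = a
      · subst hia; simpa using h2
      · rw [Function.update_of_ne hia]
        exact h1 i ((Finset.mem_insert.1 hi).resolve_left hia)
    set w := ⁅coroot a o, v⁆ with hw
    have hwc : ∀ i ∈ s, ⁅coroot i o, w⁆ = c i • w := fun i hi => by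
      rw [hw, hcomm, hc i hi, lie_smul]
    have hcube : ⁅coroot a o, ⁅coroot a o, w⁆⁆ = w := hM.coroot_cube a o v
    by_cases h0 : w = 0
    · exact ⟨v, 0, hv, hc, by rw [zero_smul, ← h0]⟩
    by_cases h1 : ⁅coroot a o, w⁆ + w = 0
    · exact ⟨w, -1, h0, hwc, by rw [eq_neg_of_add_eq_zero_left h1]; simp⟩
    · refine ⟨_, 1, h1, fun i hi => ?_, ?_⟩
      · rw [lie_add, hcomm, hwc i hi, lie_smul, smul_add]
      · rw [lie_add, hcube, one_smul, add_comm]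

/-- A nonzero square-zero module contains a highest vector: a common eigenvector of the coroots
has eigenvalues in `{0, 1, -1}` on each of them, so its weight is, up to a constant, the indicator
function of a set `S`. -/
theorem SquareZero.exists_isHighest (hM : SquareZero (n := n) M) [Nontrivial M] (hn : 0 < n) :
    ∃ (S : Finset (Fin n)) (v : M), S ≠ Finset.univ ∧ v ≠ 0 ∧ IsHighest S v := by
  classical
  let o : Fin n := ⟨0, hn⟩
  obtain ⟨v, c, hv, hc⟩ := hM.exists_eigenvector o
  have hcij : ∀ i j, ⁅coroot i j, v⁆ = (c i - c j) • v := fun i j => by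
    rw [← coroot_sub i j o, sub_lie, hc, hc, sub_smul]
  have hval : ∀ i j, c i - c j = 0 ∨ c i - c j = 1 ∨ c i - c j = -1 := fun i j => by
    have h := hM.coroot_cube i j v
    simp only [hcij, lie_smul, smul_smul] at h
    have h' := smul_left_injective ℂ hv h
    have h'' : (c i - c j) * ((c i - c j - 1) * (c i - c j + 1)) = 0 := by linear_combination h'
    rcases mul_eq_zero.1 h'' with h | h
    · exact Or.inl h
    rcases mul_eq_zero.1 h with h | h
    · exact Or.inr (Or.inl (sub_eq_zero.1 h))
    · exact Or.inr (Or.inr (eq_neg_of_add_eq_zero_left h))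
  let S : Finset (Fin n) := {i | ∃ j, c i - c j = 1}
  have hS : ∀ i, i ∈ S ↔ ∃ j, c i - c j = 1 := fun i => by simp [S]
  -- No difference `c i - c j` equals `2`.
  have h2 : ∀ i j, c i - c j ≠ 2 := fun i j h => by
    rcases hval i j with h' | h' | h' <;> rw [h'] at h <;> norm_num at h
  have hwt : ∀ i j, c i - c j = (if i ∈ S then 1 else 0) - (if j ∈ S then 1 else 0) := by
    intro i j
    by_cases hi : i ∈ S <;> by_cases hj : j ∈ S <;> simp only [hi, hj, if_true, if_false]
    · obtain ⟨k, hk⟩ := (hS i).1 hi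
      obtain ⟨l, hl⟩ := (hS j).1 hj
      rcases hval i j with h | h | h
      · rw [h, sub_self]
      · exact absurd (by linear_combination h + hl) (h2 i l)
      · exact absurd (by linear_combination hk - h) (h2 j k)
    · obtain ⟨k, hk⟩ := (hS i).1 hi
      have hjk : c j - c k ≠ 1 := fun h => hj ((hS j).2 ⟨k, h⟩)
      rcases hval j k with h | h | h
      · linear_combination hk - h
      · exact absurd h hjk
      · exact absurd (by linear_combination hk - h) (h2 i j)
    · obtain ⟨k, hk⟩ := (hS j).1 hj
      have hik : c i - c k ≠ 1 := fun h => hi ((hS i).2 ⟨k, h⟩)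
      rcases hval i k with h | h | h
      · linear_combination h - hk
      · exact absurd h hik
      · exact absurd (by linear_combination hk - h) (h2 j i)
    · rcases hval i j with h | h | h
      · rw [h, sub_self]
      · exact absurd ((hS i).2 ⟨j, h⟩) hi
      · exact absurd ((hS j).2 ⟨i, by linear_combination -h⟩) hj
  have hroot : ∀ i j (h : i ≠ j), ¬ (i ∉ S ∧ j ∈ S) → ⁅rootVec i j h, v⁆ = 0 := by
    intro i j h hij
    have h1 := hM.rootVec_coroot i j h v
    rw [hcij, lie_smul, ← add_eq_zero_iff_eq_neg] at h1
    replace h1 : (c i - c j + 1) • ⁅rootVec i j h, v⁆ = 0 := by rw [add_smul, one_smul, h1]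
    refine (smul_eq_zero.1 h1).resolve_left fun h3 => hij ?_
    have h4 : c j - c i = 1 := by linear_combination -h3
    have hj : j ∈ S := (hS j).2 ⟨i, h4⟩
    refine ⟨fun hi => ?_, hj⟩
    have h5 := hwt j i
    simp [hi, hj, h4] at h5
  refine ⟨S, v, fun hu => ?_, hv, fun A hA => ?_⟩
  · obtain ⟨j, hj⟩ := (hS o).1 (hu ▸ Finset.mem_univ o)
    have := hwt o j
    simp [hu, hj] at this
  · have hterm : ∀ i j, A.1 i j • ⁅tracelessUnit o i j, v⁆ =
        if i = j then (A.1 i i * (c i - c o)) • v else 0 := by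
      intro i j
      by_cases h : i = j
      · subst h
        rw [tracelessUnit_self, hcij, if_pos rfl, smul_smul]
      · rw [if_neg h, tracelessUnit_of_ne o i j h]
        by_cases hij : i ∉ S ∧ j ∈ S
        · rw [hA i hij.1 j hij.2, zero_smul]
        · rw [hroot i j h hij, smul_zero]
    have htr : ∑ i, A.1 i i = 0 := A.2
    conv_lhs => rw [sl_eq_sum A o]
    simp only [sum_lie, smul_lie, hterm, Finset.sum_ite_eq,
      Finset.mem_univ, if_true, ← Finset.sum_smul]
    congr 1
    simp only [hwt, mul_sub, Finset.sum_sub_distrib, ← Finset.sum_mul, htr, zero_mul, sub_zero]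
    simp

end Module

/-! ### Irreducible Lie modules and products -/

section Schur

variable {L M N : Type*} [LieRing L] [AddCommGroup M] [LieRingModule L M] [AddCommGroup N]
  [LieRingModule L N]

theorem nonempty_lieModuleEquiv_of_bijective [Module ℂ M] [Module ℂ N]
    (f : M →ₗ⁅ℂ, L⁆ N) (hf : Function.Bijective f) :
    Nonempty (M ≃ₗ⁅ℂ, L⁆ N) :=
  ⟨{ f with
      invFun := (Equiv.ofBijective f hf).symm
      left_inv := (Equiv.ofBijective f hf).left_inv
      right_inv := (Equiv.ofBijective f hf).right_inv }⟩

theorem nonempty_lieModuleEquiv_of_ne_zero [LieAlgebra ℂ L] [Module ℂ M] [Module ℂ N]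
    [LieModule ℂ L M] [LieModule ℂ L N]
    (hM : LieModule.IsIrreducible ℂ L M) (hN : LieModule.IsIrreducible ℂ L N)
    (f : M →ₗ⁅ℂ, L⁆ N) (m : M) (hf : f m ≠ 0) : Nonempty (M ≃ₗ⁅ℂ, L⁆ N) := by
  refine nonempty_lieModuleEquiv_of_bijective f
    ⟨f.ker_eq_bot.1 ((eq_bot_or_eq_top f.ker).resolve_right fun h => hf ?_),
      f.range_eq_top.1 ((eq_bot_or_eq_top f.range).resolve_left fun h => hf ?_)⟩
  · exact LieModuleHom.mem_ker.1 (h ▸ LieSubmodule.mem_top m)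
  · exact (LieSubmodule.mem_bot (R := ℂ) (L := L) _).1 (h ▸ (LieModuleHom.mem_range f _).2 ⟨m, rfl⟩)

instance prodLieRingModule : LieRingModule L (M × N) where
  bracket x m := (⁅x, m.1⁆, ⁅x, m.2⁆)
  add_lie x y m := Prod.ext (add_lie x y m.1) (add_lie x y m.2)
  lie_add x m m' := Prod.ext (lie_add x m.1 m'.1) (lie_add x m.2 m'.2)
  leibniz_lie x y m := Prod.ext (leibniz_lie x y m.1) (leibniz_lie x y m.2)

theorem lie_prod (x : L) (m : M × N) : ⁅x, m⁆ = (⁅x, m.1⁆, ⁅x, m.2⁆) := rfl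

instance prodLieModule [LieAlgebra ℂ L] [Module ℂ M] [Module ℂ N] [LieModule ℂ L M]
    [LieModule ℂ L N] : LieModule ℂ L (M × N) where
  smul_lie c x m := Prod.ext (smul_lie c x m.1) (smul_lie c x m.2)
  lie_smul c x m := Prod.ext (lie_smul c x m.1) (lie_smul c x m.2)

end Schur

/-! ### The submodule generated by a highest vector -/

section Highest

variable {n : ℕ}

/-- The matrix `diag(1_S) - (|S| / n) 1`, which grades `𝔰𝔩_n` in degrees `-1, 0, 1`. -/
def gradingElt (hn : n ≠ 0) (S : Finset (Fin n)) : sl n :=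
  ⟨Matrix.diagonal fun i => (if i ∈ S then 1 else 0) - (S.card : ℂ) / n, by
    change Matrix.trace (Matrix.diagonal fun i => (if i ∈ S then 1 else 0) - (S.card : ℂ) / n) = 0
    have : (n : ℂ) ≠ 0 := Nat.cast_ne_zero.2 hn
    simp only [Matrix.trace_diagonal, Finset.sum_sub_distrib, Finset.sum_const, Finset.card_univ,
      Fintype.card_fin, Finset.sum_ite_mem, Finset.univ_inter, nsmul_eq_mul, mul_one]
    field_simp
    ring⟩

/-- The matrices supported on the block `Sᶜ × S`. -/
def IsLowering (S : Finset (Fin n)) (X : sl n) : Prop :=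
  ∀ i j, ¬ (i ∉ S ∧ j ∈ S) → X.1 i j = 0

theorem lie_gradingElt (hn : n ≠ 0) {S : Finset (Fin n)} {X : sl n} (hX : IsLowering S X) :
    ⁅gradingElt hn S, X⁆ = -X := by
  refine Subtype.ext ?_
  rw [sl_lie_val]
  change _ = -X.1
  ext i j
  rw [Matrix.sub_apply, gradingElt, Matrix.diagonal_mul, Matrix.mul_diagonal, Matrix.neg_apply]
  by_cases h : i ∉ S ∧ j ∈ S
  · simp [h.1, h.2]
    ring
  · simp [hX i j h]

theorem exists_lowering_add (S : Finset (Fin n)) (A : sl n) : ∃ X B : sl n, A = X + B ∧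
    IsLowering S X ∧ ∀ i, i ∉ S → ∀ j, j ∈ S → B.1 i j = 0 := by
  let X : sl n := ⟨Matrix.of fun i j => if i ∉ S ∧ j ∈ S then A.1 i j else 0, by
    change Matrix.trace (Matrix.of fun i j => if i ∉ S ∧ j ∈ S then A.1 i j else 0) = 0
    exact Finset.sum_eq_zero fun i _ => if_neg fun h => h.1 h.2⟩
  have hX : ∀ i j, X.1 i j = if i ∉ S ∧ j ∈ S then A.1 i j else 0 := fun i j => rfl
  refine ⟨X, A - X, by abel, fun i j h => (hX i j).trans (if_neg h), fun i hi j hj => ?_⟩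
  change A.1 i j - X.1 i j = 0
  rw [hX, if_pos ⟨hi, hj⟩, sub_self]

variable {M : Type*} [AddCommGroup M] [Module ℂ M] [LieRingModule (sl n) M]

/-- The span of the products of `d` lowering matrices applied to `v`. -/
def lowered (S : Finset (Fin n)) (v : M) : ℕ → Submodule ℂ M
  | 0 => Submodule.span ℂ {v}
  | d + 1 => Submodule.span ℂ {y | ∃ X : sl n, IsLowering S X ∧ ∃ w ∈ lowered S v d, y = ⁅X, w⁆}

/-- The eigenvalue of the grading element on a highest vector. -/
def topDegree (n : ℕ) (S : Finset (Fin n)) : ℂ := ∑ _i ∈ S, (1 - (S.card : ℂ) / n)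

theorem IsHighest.lie_gradingElt (hn : n ≠ 0) {S : Finset (Fin n)} {v : M} (hv : IsHighest S v) :
    ⁅gradingElt hn S, v⁆ = topDegree n S • v := by
  rw [hv _ fun i hi j hj => ?_]
  · congr 1
    exact Finset.sum_congr rfl fun i hi => by simp [gradingElt, hi]
  · exact Matrix.diagonal_apply_ne _ fun h => hi (h ▸ hj)

variable [LieModule ℂ (sl n) M]

theorem lie_gradingElt_of_mem_lowered (hn : n ≠ 0) {S : Finset (Fin n)} {v : M}
    (hv : IsHighest S v) (d : ℕ) : ∀ w ∈ lowered S v d,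
      ⁅gradingElt hn S, w⁆ = (topDegree n S - d) • w := by
  induction d with
  | zero =>
    intro w hw
    obtain ⟨c, rfl⟩ := Submodule.mem_span_singleton.1 hw
    rw [lie_smul, hv.lie_gradingElt hn, smul_comm, Nat.cast_zero, sub_zero]
  | succ d ih =>
    intro w hw
    induction hw using Submodule.span_induction with
    | mem y h =>
      obtain ⟨X, hX, w, hw, rfl⟩ := h
      rw [leibniz_lie, TorusVF.lie_gradingElt hn hX, ih w hw, lie_smul, neg_lie]
      push_cast
      module
    | zero => simp
    | add x y _ _ hx hy => rw [lie_add, hx, hy, smul_add]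
    | smul c x _ hx => rw [lie_smul, hx, smul_comm]

theorem lie_mem_iSup_lowered {S : Finset (Fin n)} {v : M} (hv : IsHighest S v) (d : ℕ) :
    ∀ w ∈ lowered S v d, ∀ A : sl n, ⁅A, w⁆ ∈ ⨆ d, lowered S v d := by
  -- The span of all iterated lowerings is stable under lowering matrices by construction.
  have hlow : ∀ X : sl n, IsLowering S X → ∀ w ∈ ⨆ d, lowered S v d,
      ⁅X, w⁆ ∈ ⨆ d, lowered S v d := by
    intro X hX w hw
    induction hw using Submodule.iSup_induction' with
    | mem d w hw =>
      exact Submodule.mem_iSup_of_mem (d + 1) (Submodule.subset_span ⟨X, hX, w, hw, rfl⟩)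
    | zero => rw [lie_zero]; exact zero_mem _
    | add x y _ _ hx hy => rw [lie_add]; exact add_mem hx hy
  have hle : ∀ d, ∀ w ∈ lowered S v d, w ∈ ⨆ d, lowered S v d :=
    fun d w hw => Submodule.mem_iSup_of_mem d hw
  induction d with
  | zero =>
    intro w hw A
    obtain ⟨X, B, rfl, hX, hB⟩ := exists_lowering_add S A
    rw [add_lie]
    refine add_mem (hlow X hX w (hle 0 w hw)) ?_
    obtain ⟨c, rfl⟩ := Submodule.mem_span_singleton.1 hw
    rw [lie_smul, hv B hB]
    exact Submodule.smul_mem _ _ (Submodule.smul_mem _ _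
      (hle 0 v (Submodule.mem_span_singleton_self v)))
  | succ d ih =>
    intro w hw A
    induction hw using Submodule.span_induction with
    | mem y h =>
      obtain ⟨X, hX, w, hw, rfl⟩ := h
      rw [leibniz_lie]
      exact add_mem (ih w hw _) (hlow X hX _ (ih w hw A))
    | zero => rw [lie_zero]; exact zero_mem _
    | add x y _ _ hx hy => rw [lie_add]; exact add_mem hx hy
    | smul c x _ hx => rw [lie_smul]; exact Submodule.smul_mem _ _ hx

/-- The grading element acts on the submodule generated by a highest vector `v` with top eigenspace
`ℂ v`. -/
theorem IsHighest.eq_smul_of_mem_lieSpan (hn : n ≠ 0) {S : Finset (Fin n)} {v : M}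
    (hv : IsHighest S v) {x : M} (hx : x ∈ LieSubmodule.lieSpan ℂ (sl n) {v})
    (hgr : ⁅gradingElt hn S, x⁆ = topDegree n S • x) : ∃ c : ℂ, x = c • v := by
  let N : LieSubmodule ℂ (sl n) M :=
    { (⨆ d, lowered S v d : Submodule ℂ M) with
      lie_mem := by
        intro A w hw
        change w ∈ ⨆ d, lowered S v d at hw
        change ⁅A, w⁆ ∈ ⨆ d, lowered S v d
        induction hw using Submodule.iSup_induction' with
        | mem d w hw => exact lie_mem_iSup_lowered hv d w hw A
        | zero => rw [lie_zero]; exact zero_mem _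
        | add x y _ _ hx hy => rw [lie_add]; exact add_mem hx hy }
  have hvN : v ∈ N :=
    Submodule.mem_iSup_of_mem (p := lowered S v) 0 (Submodule.mem_span_singleton_self _)
  have hle : LieSubmodule.lieSpan ℂ (sl n) {v} ≤ N :=
    LieSubmodule.lieSpan_le.2 (Set.singleton_subset_iff.2 hvN)
  have hxN : x ∈ N := hle hx
  replace hxN : x ∈ ⨆ d, lowered S v d := hxN
  set h : Module.End ℂ M := LieModule.toEnd ℂ (sl n) M (gradingElt hn S)
  have hle : ⨆ d, lowered S v d ≤
      lowered S v 0 ⊔ ⨆ (μ : ℂ) (_ : μ ≠ topDegree n S), h.eigenspace μ := by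
    refine iSup_le fun d => ?_
    rcases Nat.eq_zero_or_pos d with rfl | hd
    · exact le_sup_left
    · refine le_sup_of_le_right (le_iSup₂_of_le (topDegree n S - d) ?_ fun w hw => ?_)
      · simpa using hd.ne'
      · exact Module.End.mem_eigenspace_iff.2 (lie_gradingElt_of_mem_lowered hn hv d w hw)
  obtain ⟨y, hy, w, hw, rfl⟩ := Submodule.mem_sup.1 (hle hxN)
  obtain ⟨c, rfl⟩ := Submodule.mem_span_singleton.1 hy
  refine ⟨c, ?_⟩
  have hw' : w ∈ h.eigenspace (topDegree n S) := by
    refine Module.End.mem_eigenspace_iff.2 ?_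
    rw [lie_add, lie_smul, hv.lie_gradingElt hn, smul_add, smul_comm c, add_right_inj] at hgr
    exact hgr
  have := Submodule.disjoint_def.1 (h.eigenspaces_iSupIndep (topDegree n S)) w hw' hw
  rw [this, add_zero]

end Highest

section Uniqueness

variable {n : ℕ} {M M' : Type*} [AddCommGroup M] [Module ℂ M] [LieRingModule (sl n) M]
  [LieModule ℂ (sl n) M] [AddCommGroup M'] [Module ℂ M'] [LieRingModule (sl n) M']
  [LieModule ℂ (sl n) M']

/-- Irreducible modules with highest vectors `v`, `v'` for the same set `S` are isomorphic: the
submodule of `M × M'` generated by `(v, v')` contains neither `(v, 0)` nor `(0, v')`, so it is the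
graph of an isomorphism. -/
theorem IsHighest.nonempty_equiv (hn : n ≠ 0) (hM : LieModule.IsIrreducible ℂ (sl n) M)
    (hM' : LieModule.IsIrreducible ℂ (sl n) M') {S : Finset (Fin n)} {v : M} {v' : M'}
    (hv : IsHighest S v) (hv' : IsHighest S v') (h0 : v ≠ 0) (h0' : v' ≠ 0) :
    Nonempty (M ≃ₗ⁅ℂ, sl n⁆ M') := by
  have hvv : IsHighest S (v, v') := fun A hA => by
    rw [lie_prod, hv A hA, hv' A hA]; rfl
  set N := LieSubmodule.lieSpan ℂ (sl n) {(v, v')}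
  have hmem : (v, v') ∈ N := LieSubmodule.subset_lieSpan rfl
  let inl : M →ₗ⁅ℂ, sl n⁆ M × M' :=
    { LinearMap.inl ℂ M M' with map_lie' := fun {x m} => Prod.ext rfl (lie_zero x).symm }
  let inr : M' →ₗ⁅ℂ, sl n⁆ M × M' :=
    { LinearMap.inr ℂ M M' with map_lie' := fun {x m} => Prod.ext (lie_zero x).symm rfl }
  let p : N →ₗ⁅ℂ, sl n⁆ M :=
    { LinearMap.fst ℂ M M' ∘ₗ N.toSubmodule.subtype with map_lie' := fun {x m} => rfl }
  let p' : N →ₗ⁅ℂ, sl n⁆ M' :=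
    { LinearMap.snd ℂ M M' ∘ₗ N.toSubmodule.subtype with map_lie' := fun {x m} => rfl }
  have hinl : N.comap inl = ⊥ := (eq_bot_or_eq_top _).resolve_right fun h => by
    have h1 : (v, (0 : M')) ∈ N := (h ▸ LieSubmodule.mem_top v : v ∈ N.comap inl)
    obtain ⟨c, hc⟩ := hvv.eq_smul_of_mem_lieSpan hn h1 (by
      rw [lie_prod, hv.lie_gradingElt hn, lie_zero]; simp)
    have h2 : (0 : M') = c • v' := congrArg Prod.snd hc
    have h3 : v = c • v := congrArg Prod.fst hc
    rw [(smul_eq_zero.1 h2.symm).resolve_right h0', zero_smul] at h3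
    exact h0 h3
  have hinr : N.comap inr = ⊥ := (eq_bot_or_eq_top _).resolve_right fun h => by
    have h1 : ((0 : M), v') ∈ N := (h ▸ LieSubmodule.mem_top v' : v' ∈ N.comap inr)
    obtain ⟨c, hc⟩ := hvv.eq_smul_of_mem_lieSpan hn h1 (by
      rw [lie_prod, hv'.lie_gradingElt hn, lie_zero]; simp)
    have h2 : (0 : M) = c • v := congrArg Prod.fst hc
    have h3 : v' = c • v' := congrArg Prod.snd hc
    rw [(smul_eq_zero.1 h2.symm).resolve_right h0, zero_smul] at h3
    exact h0' h3
  have hp : Function.Bijective p := by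
    refine ⟨(injective_iff_map_eq_zero p).2 ?_, p.range_eq_top.1
      ((eq_bot_or_eq_top p.range).resolve_left fun h => h0 ?_)⟩
    · rintro ⟨⟨x, y⟩, hxy⟩ (rfl : x = 0)
      have : y ∈ N.comap inr := hxy
      rw [hinr, LieSubmodule.mem_bot] at this
      subst this
      rfl
    · exact (LieSubmodule.mem_bot (R := ℂ) (L := sl n) _).1
        (h ▸ (LieModuleHom.mem_range p _).2 ⟨⟨_, hmem⟩, rfl⟩)
  have hp' : Function.Bijective p' := by
    refine ⟨(injective_iff_map_eq_zero p').2 ?_, p'.range_eq_top.1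
      ((eq_bot_or_eq_top p'.range).resolve_left fun h => h0' ?_)⟩
    · rintro ⟨⟨x, y⟩, hxy⟩ (rfl : y = 0)
      have : x ∈ N.comap inl := hxy
      rw [hinl, LieSubmodule.mem_bot] at this
      subst this
      rfl
    · exact (LieSubmodule.mem_bot (R := ℂ) (L := sl n) _).1
        (h ▸ (LieModuleHom.mem_range p' _).2 ⟨⟨_, hmem⟩, rfl⟩)
  obtain ⟨e⟩ := nonempty_lieModuleEquiv_of_bijective p hp
  obtain ⟨e'⟩ := nonempty_lieModuleEquiv_of_bijective p' hp'
  exact ⟨e.symm.trans e'⟩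

end Uniqueness

/-! ### Exterior powers -/

/-- The wedge product `e_{f 0} ∧ ⋯ ∧ e_{f (k-1)}` of standard basis vectors. -/
def wedgeBasis {n k : ℕ} (f : Fin k → Fin n) : ExtPow n k := wedge n k fun a => Pi.single (f a) 1

theorem squareZero_extPow (n k : ℕ) : SquareZero (n := n) (ExtPow n k) := by
  intro i j hij w
  suffices h : extOp n k (rootVec i j hij).1 ∘ₗ extOp n k (rootVec i j hij).1 = 0 from
    LinearMap.congr_fun h w
  refine extPow_hom_ext fun v => ?_
  have hE : ∀ x : Fin n → ℂ, (rootVec i j hij).1.mulVec x = x j • Pi.single i 1 := by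
    intro x
    rw [rootVec_val]
    ext l
    simp [Matrix.single_mulVec, Function.update_apply, Pi.single_apply]
  rw [LinearMap.comp_apply, extOp_wedge, map_sum, LinearMap.zero_apply]
  refine Finset.sum_eq_zero fun a _ => ?_
  rw [extOp_wedge]
  refine Finset.sum_eq_zero fun b _ => ?_
  by_cases hab : b = a
  · subst hab
    refine (wedge n k).map_coord_zero b ?_
    simp [hE, hij.symm]
  · rw [hE (v a), hE, AlternatingMap.map_update_smul, Function.update_comm (Ne.symm hab),
      AlternatingMap.map_update_smul,
      (wedge n k).map_eq_zero_of_eq _ (i := a) (j := b) (by simp [hab]) (Ne.symm hab),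
      smul_zero, smul_zero]

theorem lie_wedgeBasis {n k : ℕ} (A : sl n) (f : Fin k → Fin n) :
    ⁅A, wedgeBasis f⁆ = ∑ a, ∑ i, A.1 i (f a) • wedgeBasis (Function.update f a i) := by
  rw [wedgeBasis, lie_wedge]
  refine Finset.sum_congr rfl fun a _ => ?_
  have h : A.1.mulVec (Pi.single (f a) 1) = ∑ i, A.1 i (f a) • (Pi.single i 1 : Fin n → ℂ) := by
    ext l
    simp [Finset.sum_apply, Pi.single_apply]
  rw [h, AlternatingMap.map_update_sum]
  refine Finset.sum_congr rfl fun i _ => ?_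
  rw [AlternatingMap.map_update_smul, wedgeBasis]
  congr 2
  funext b
  by_cases hb : b = a
  · subst hb; simp
  · simp [hb]

theorem wedgeBasis_eq_zero {n k : ℕ} (f : Fin k → Fin n) (a b : Fin k) (h : f a = f b)
    (hab : a ≠ b) : wedgeBasis f = 0 :=
  (wedge n k).map_eq_zero_of_eq _ (by simp [h]) hab

theorem isHighest_wedgeBasis {n k : ℕ} (f : Fin k → Fin n) (hf : Function.Injective f) :
    IsHighest (Finset.univ.image f) (wedgeBasis f) := by
  intro A hA
  rw [lie_wedgeBasis, Finset.sum_image fun a _ b _ h => hf h, Finset.sum_smul]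
  refine Finset.sum_congr rfl fun a _ => ?_
  rw [Finset.sum_eq_single (f a) (fun i _ hi => ?_) (by simp), Function.update_eq_self]
  by_cases hiS : i ∈ Finset.univ.image f
  · obtain ⟨b, -, rfl⟩ := Finset.mem_image.1 hiS
    have hba : b ≠ a := fun h => hi (h ▸ rfl)
    rw [wedgeBasis_eq_zero _ b a (by simp [hba]) hba, smul_zero]
  · rw [hA i hiS (f a) (Finset.mem_image_of_mem f (Finset.mem_univ a)), zero_smul]

/-- The increasing enumeration of a `k`-element subset. -/
def enum {n k : ℕ} (s : Set.powersetCard (Fin n) k) : Fin k → Fin n :=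
  Set.powersetCard.ofFinEmbEquiv.symm s

/-- The basis of `⋀^k(ℂⁿ)` indexed by the `k`-element subsets. -/
def extBasis (n k : ℕ) : Module.Basis (Set.powersetCard (Fin n) k) ℂ (ExtPow n k) :=
  (Pi.basisFun ℂ (Fin n)).exteriorPower k

theorem extBasis_apply {n k : ℕ} (s : Set.powersetCard (Fin n) k) :
    extBasis n k s = wedgeBasis (enum s) := by
  refine (exteriorPower.basis_apply ℂ k (Pi.basisFun ℂ (Fin n)) s).trans ?_
  rw [exteriorPower.ιMulti_family, wedgeBasis, wedge]
  congr 1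
  funext a
  simp [enum]

theorem enum_injective {n k : ℕ} (s : Set.powersetCard (Fin n) k) :
    Function.Injective (enum s) :=
  (Set.powersetCard.ofFinEmbEquiv.symm s).injective

theorem image_enum {n k : ℕ} (s : Set.powersetCard (Fin n) k) :
    Finset.univ.image (enum s) = s.1 := by
  ext i
  rw [Finset.mem_image]
  have h := Set.powersetCard.mem_range_ofFinEmbEquiv_symm_iff_mem s i
  exact ⟨fun ⟨a, _, ha⟩ => h.1 ⟨a, ha⟩, fun hi => (h.2 hi).imp fun a ha => ⟨Finset.mem_univ a, ha⟩⟩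

theorem IsHighest.lie_coroot {n : ℕ} {M : Type*} [AddCommGroup M] [Module ℂ M]
    [LieRingModule (sl n) M] {S : Finset (Fin n)} {v : M} (hv : IsHighest S v) (i j : Fin n) :
    ⁅coroot i j, v⁆ = ((if i ∈ S then 1 else 0) - (if j ∈ S then 1 else 0) : ℂ) • v := by
  rw [hv]
  · congr 1
    simp [coroot_val, Matrix.single_apply]
  · intro a ha b hb
    have hab : a ≠ b := fun h => ha (h ▸ hb)
    have h : ∀ l : Fin n, ¬ (l = a ∧ l = b) := fun l h => hab (h.1.symm.trans h.2)
    simp [coroot_val, h]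

theorem extBasis_repr_lie_coroot {n k : ℕ} (i j : Fin n) (s : Set.powersetCard (Fin n) k)
    (w : ExtPow n k) : (extBasis n k).repr ⁅coroot i j, w⁆ s =
      ((if i ∈ s.1 then 1 else 0) - (if j ∈ s.1 then 1 else 0)) * (extBasis n k).repr w s := by
  suffices h : (extBasis n k).coord s ∘ₗ LieModule.toEnd ℂ (sl n) (ExtPow n k) (coroot i j) =
      ((if i ∈ s.1 then 1 else 0) - (if j ∈ s.1 then 1 else 0) : ℂ) • (extBasis n k).coord s from
    LinearMap.congr_fun h w
  refine (extBasis n k).ext fun t => ?_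
  have ht := (isHighest_wedgeBasis (enum t) (enum_injective t)).lie_coroot i j
  rw [image_enum, ← extBasis_apply] at ht
  simp only [LinearMap.comp_apply, LieModule.toEnd_apply_apply, ht, map_smul, LinearMap.smul_apply,
    Module.Basis.coord_apply, Module.Basis.repr_self, smul_eq_mul]
  by_cases hst : t = s
  · subst hst; rfl
  · rw [Finsupp.single_eq_of_ne (Ne.symm hst), mul_zero, mul_zero]

/-- Proper subsets are determined by the differences of the values of their indicator functions. -/
theorem eq_of_indicator_sub {n : ℕ} {S T : Finset (Fin n)} (hS : S ≠ Finset.univ)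
    (hT : T ≠ Finset.univ) (h : ∀ i j, ((if i ∈ S then 1 else 0) - (if j ∈ S then 1 else 0) : ℂ) =
      (if i ∈ T then 1 else 0) - (if j ∈ T then 1 else 0)) : S = T := by
  obtain ⟨a, ha⟩ : ∃ a, a ∉ S := by simpa [Finset.eq_univ_iff_forall] using hS
  obtain ⟨b, hb⟩ : ∃ b, b ∉ T := by simpa [Finset.eq_univ_iff_forall] using hT
  have hab : a ∉ T := fun haT => by
    have := h a b
    by_cases hbS : b ∈ S <;> simp [ha, hb, haT, hbS] at this
    norm_num at this
  ext i
  have := h i a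
  by_cases hi : i ∈ S <;> by_cases hi' : i ∈ T <;> simp_all

/-- Suitable root vectors and transpositions turn one wedge of distinct basis vectors into any
other. -/
theorem wedgeBasis_mem {n k : ℕ} (N : LieSubmodule ℂ (sl n) (ExtPow n k)) {f : Fin k → Fin n}
    (hf : Function.Injective f) (d : ℕ) : ∀ g : Fin k → Fin n, Function.Injective g →
      wedgeBasis g ∈ N → (Finset.univ.filter fun a => g a ≠ f a).card = d → wedgeBasis f ∈ N := by
  induction d using Nat.strong_induction_on with
  | _ d ih =>
    intro g hg hgN hd
    by_cases hgf : ∀ a, g a = f a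
    · rwa [← funext hgf]
    push Not at hgf
    obtain ⟨a, ha⟩ := hgf
    suffices h : ∃ g', Function.Injective g' ∧ wedgeBasis g' ∈ N ∧ g' a = f a ∧
        ∀ b, g' b ≠ f b → g b ≠ f b by
      obtain ⟨g', h1, h2, h3, h4⟩ := h
      refine ih _ ?_ g' h1 h2 rfl
      rw [← hd]
      refine Finset.card_lt_card ⟨fun b hb => ?_, fun hsub => ?_⟩
      · simp only [Finset.mem_filter, Finset.mem_univ, true_and] at hb ⊢
        exact h4 b hb
      · have := hsub (Finset.mem_filter.2 ⟨Finset.mem_univ a, ha⟩)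
        exact (Finset.mem_filter.1 this).2 h3
    by_cases hr : ∃ b, g b = f a
    · obtain ⟨b, hb⟩ := hr
      have hba : b ≠ a := fun h => ha (h ▸ hb)
      refine ⟨g ∘ Equiv.swap b a, hg.comp (Equiv.injective _), ?_, by simp [hb], fun c hc => ?_⟩
      · have : wedgeBasis (g ∘ Equiv.swap b a) = -wedgeBasis g :=
          (wedge n k).map_swap (fun c => Pi.single (g c) 1) hba
        rw [this]
        exact neg_mem hgN
      · by_cases hcb : c = b
        · subst hcb
          rw [hb]
          exact fun h => hba (hf h).symm
        · by_cases hca : c = a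
          · subst hca; exact ha
          · simpa [Equiv.swap_apply_of_ne_of_ne hcb hca] using hc
    · push Not at hr
      refine ⟨Function.update g a (f a), ?_, ?_, by simp, fun c hc => ?_⟩
      · intro c d hcd
        by_cases hc : c = a <;> by_cases hd : d = a
        · rw [hc, hd]
        · subst hc
          simp only [Function.update_self, Function.update_of_ne hd] at hcd
          exact absurd hcd.symm (hr d)
        · subst hd
          simp only [Function.update_self, Function.update_of_ne hc] at hcd
          exact absurd hcd (hr c)
        · simp only [Function.update_of_ne hc, Function.update_of_ne hd] at hcd
          exact hg hcd
      · have h1 := N.lie_mem (x := rootVec (f a) (g a) (Ne.symm ha)) hgN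
        rw [lie_wedgeBasis, Finset.sum_eq_single a, Finset.sum_eq_single (f a)] at h1
        · simpa [rootVec_val] using h1
        · intro i _ hi
          simp [rootVec_val, Ne.symm hi]
        · simp
        · intro b _ hb
          refine Finset.sum_eq_zero fun i _ => ?_
          have : g a ≠ g b := fun h => hb (hg h).symm
          simp [rootVec_val, this]
        · simp
      · by_cases hca : c = a
        · subst hca; exact ha
        · simpa [hca] using hc

/-- A nonzero submodule contains a highest vector, which has to be a multiple of a basis vector
since the weights of the basis vectors are distinct. -/
theorem isIrreducible_extPow {n k : ℕ} (hk : k < n) :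
    LieModule.IsIrreducible ℂ (sl n) (ExtPow n k) := by
  have hne : Nonempty (Set.powersetCard (Fin n) k) := by
    obtain ⟨s, -, hs⟩ := Finset.exists_subset_card_eq (s := (Finset.univ : Finset (Fin n)))
      (n := k) (by simpa using hk.le)
    exact ⟨⟨s, hs⟩⟩
  have : Nontrivial (ExtPow n k) := (extBasis n k).repr.toEquiv.nontrivial
  refine LieModule.IsIrreducible.mk fun N hN => ?_
  have : Nontrivial N := (LieSubmodule.nontrivial_iff_ne_bot ℂ (sl n) (ExtPow n k)).2 hN
  have hsq : SquareZero (n := n) N := fun i j h m =>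
    Subtype.ext (squareZero_extPow n k i j h m.1)
  obtain ⟨S, ⟨v, hvN⟩, hS, hv0, hv⟩ := hsq.exists_isHighest (by omega)
  have hv0' : v ≠ 0 := fun h => hv0 (Subtype.ext h)
  have hv' : IsHighest S v := fun A hA => congrArg Subtype.val (hv A hA)
  have hcoef : ∀ s, (extBasis n k).repr v s ≠ 0 → s.1 = S := by
    intro s hs
    refine eq_of_indicator_sub (fun h => ?_) hS fun i j => ?_
    · have := s.2
      rw [Set.powersetCard.mem_iff, h, Finset.card_univ, Fintype.card_fin] at this
      omega
    · have h := extBasis_repr_lie_coroot i j s v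
      rw [hv'.lie_coroot, map_smul, Finsupp.smul_apply, smul_eq_mul] at h
      exact (mul_right_cancel₀ hs h).symm
  obtain ⟨s, hs⟩ : ∃ s, (extBasis n k).repr v s ≠ 0 := by
    by_contra! h
    exact hv0' ((extBasis n k).repr.map_eq_zero_iff.1 (Finsupp.ext h))
  have hvs : v = (extBasis n k).repr v s • extBasis n k s := by
    refine (extBasis n k).repr.injective (Finsupp.ext fun t => ?_)
    rw [map_smul, Module.Basis.repr_self, Finsupp.smul_single, smul_eq_mul, mul_one]
    by_cases hst : s = t
    · subst hst; simp
    · rw [Finsupp.single_eq_of_ne (Ne.symm hst)]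
      by_contra h
      exact hst (Subtype.ext ((hcoef s hs).trans (hcoef t h).symm))
  have hsN : wedgeBasis (enum s) ∈ N := by
    rw [← extBasis_apply, ← inv_smul_smul₀ hs (extBasis n k s), ← hvs]
    exact N.smul_mem _ hvN
  rw [← LieSubmodule.toSubmodule_eq_top, eq_top_iff, ← (extBasis n k).span_eq, Submodule.span_le]
  rintro _ ⟨t, rfl⟩
  rw [extBasis_apply]
  exact wedgeBasis_mem N (enum_injective t) _ (enum s) (enum_injective s) hsN rfl

/-- The fundamental modules `⋀^k(ℂⁿ)`, `k < n`, are the only irreducible modules on which all root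
vectors square to zero. -/
theorem SquareZero.exists_equiv_extPow {n : ℕ} (hn : n ≠ 0) {M : Type*} [AddCommGroup M]
    [Module ℂ M] [LieRingModule (sl n) M] [LieModule ℂ (sl n) M] (hM : SquareZero (n := n) M)
    (hirr : LieModule.IsIrreducible ℂ (sl n) M) :
    ∃ k < n, Nonempty (M ≃ₗ⁅ℂ, sl n⁆ ExtPow n k) := by
  have := LieModule.nontrivial_of_isIrreducible ℂ (sl n) M
  obtain ⟨S, v, hS, hv0, hv⟩ := hM.exists_isHighest (Nat.pos_of_ne_zero hn)
  have hk : S.card < n := by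
    simpa using Finset.card_lt_univ_of_notMem
      (by simpa [Finset.eq_univ_iff_forall] using hS : ∃ a, a ∉ S).choose_spec
  let s : Set.powersetCard (Fin n) S.card := ⟨S, rfl⟩
  have h := isHighest_wedgeBasis (enum s) (enum_injective s)
  rw [image_enum] at h
  refine ⟨S.card, hk, hv.nonempty_equiv hn hirr (isIrreducible_extPow hk) h hv0 ?_⟩
  rw [← extBasis_apply]
  exact (extBasis n S.card).ne_zero s

/-! ### Operators on `P ⊗ V` -/

section Operators

variable {n : ℕ} (P V : Type*) [AddCommGroup P] [Module ℂ P] [Module (weyl n) P]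
  [IsScalarTower ℂ (weyl n) P] [AddCommGroup V] [Module ℂ V]

theorem tensorOp_mul (a b : weyl n) (Y Z : Module.End ℂ V) :
    tensorOp P V a Y * tensorOp P V b Z = tensorOp P V (a * b) (Y * Z) := by
  refine TensorProduct.ext' fun z y => ?_
  simp [tensorOp_tmul, mul_smul]

theorem x_zero : (weyl.x 0 : weyl n) = 1 := by
  ext1
  change LinearMap.mulLeft ℂ (mono 0) = 1
  have : (mono 0 : Laurent n) = 1 := rfl
  rw [this, LinearMap.mulLeft_one]
  rfl

variable [LieRingModule (sl n) V] [LieModule ℂ (sl n) V]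

theorem act_eq (u : Fin n → ℂ) (r : Fin n → ℤ) (h : pair u r = 0) :
    act P V (divFree.D u r h) =
      tensorOp P V (weyl.x r * ∑ i, u i • weyl.d i) 1 +
        tensorOp P V (weyl.x r) (slOp n V (outer u r h)) := by
  rw [← toWeyl_D u r h]
  simp [act, symbol_D]

theorem pair_single {i : Fin n} (c : ℂ) (r : Fin n → ℤ) : pair (Pi.single i c) r = c * r i := by
  rw [pair, Finset.sum_eq_single i (fun j _ hj => by simp [hj]) (by simp), Pi.single_eq_same]

theorem act_euler (i : Fin n) (h : pair (Pi.single i 1) 0 = 0) :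
    act P V (divFree.D (Pi.single i 1) 0 h) = tensorOp P V (weyl.d i) 1 := by
  have h0 : outer (Pi.single i 1) 0 h = 0 := Subtype.ext (by
    change Matrix.vecMulVec _ _ = (0 : Matrix (Fin n) (Fin n) ℂ)
    ext; simp [Matrix.vecMulVec_apply])
  rw [act_eq, h0, x_zero, Finset.sum_eq_single i (fun j _ hj => by simp [hj]) (by simp)]
  simp

/-- The coefficient vector `(r_i - m) e_j - r_j e_i` is orthogonal to `r - m e_i`. -/
theorem pair_shift (i j : Fin n) (h : i ≠ j) (r : Fin n → ℤ) (m : ℕ) :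
    pair (Pi.single j ((r i : ℂ) - m) - Pi.single i (r j : ℂ)) (r - Pi.single i (m : ℤ)) = 0 := by
  rw [pair_sub_left, pair_single, pair_single]
  simp [h.symm]
  ring

theorem pair_single_single (i j : Fin n) (h : i ≠ j) (m : ℕ) :
    pair (Pi.single j 1) (Pi.single i (m : ℤ)) = 0 := by
  simp [pair_single, h.symm]

theorem outer_single_single (i j : Fin n) (h : i ≠ j) (m : ℕ) :
    outer (Pi.single j 1) (Pi.single i (m : ℤ)) (pair_single_single i j h m) =
      (m : ℂ) • rootVec i j h := by
  refine Subtype.ext ?_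
  change Matrix.vecMulVec _ _ = (m : ℂ) • (rootVec i j h).1
  rw [rootVec_val]
  ext a b
  by_cases ha : a = i <;> by_cases hb : b = j <;>
    simp [Matrix.vecMulVec_apply, Pi.single_apply, ha, hb, Ne.symm]

theorem outer_shift (i j : Fin n) (h : i ≠ j) (r : Fin n → ℤ) (m : ℕ) :
    outer _ _ (pair_shift i j h r m) = outer _ _ (pair_shift i j h r 0) +
      (m : ℂ) • (outer _ _ (pair_shift i j h r 1) - outer _ _ (pair_shift i j h r 0) -
        rootVec i j h) + ((m : ℂ) ^ 2) • rootVec i j h := by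
  refine Subtype.ext ?_
  change _ = (outer _ _ (pair_shift i j h r 0)).1 +
      (m : ℂ) • ((outer _ _ (pair_shift i j h r 1)).1 - (outer _ _ (pair_shift i j h r 0)).1 -
        (rootVec i j h).1) + ((m : ℂ) ^ 2) • (rootVec i j h).1
  rw [rootVec_val]
  ext a b
  have hs : (Matrix.single i j (1 : ℂ)) a b =
      (Pi.single i (1 : ℂ) : Fin n → ℂ) a * (Pi.single j (1 : ℂ) : Fin n → ℂ) b := by
    by_cases ha : a = i <;> by_cases hb : b = j <;>
      simp [ha, hb, Ne.symm]
  have hz : ∀ z : ℤ, (((Pi.single i z : Fin n → ℤ) a : ℤ) : ℂ) =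
      z * (Pi.single i (1 : ℂ) : Fin n → ℂ) a := by
    intro z
    by_cases ha : a = i
    · subst ha; simp
    · simp [ha]
  have hc : ∀ (l : Fin n) (c : ℂ), (Pi.single l c : Fin n → ℂ) b =
      c * (Pi.single l (1 : ℂ) : Fin n → ℂ) b := by
    intro l c
    by_cases hb : b = l
    · subst hb; simp
    · simp [hb]
  simp only [outer, Matrix.add_apply, Matrix.smul_apply, Matrix.sub_apply, Matrix.vecMulVec_apply,
    hs, Pi.sub_apply, Int.cast_sub, hz, smul_eq_mul]
  simp only [hc j (_ - _), hc i (r j : ℂ)]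
  push_cast
  ring

/-- The product of `D((r_i - m) e_j - r_j e_i, r - m e_i)` and `D(e_j, m e_i)` acts as a polynomial
of degree three in `m`, whose leading coefficient involves the square of the root vector `E_ij`. -/
theorem exists_act_mul_act (i j : Fin n) (h : i ≠ j) (r : Fin n → ℤ) :
    ∃ C₀ C₁ C₂ : Module.End ℂ (P ⊗[ℂ] V), ∀ m : ℕ,
      act P V (divFree.D _ _ (pair_shift i j h r m)) *
        act P V (divFree.D _ _ (pair_single_single i j h m)) =
      C₀ + (m : ℂ) • C₁ + ((m : ℂ) ^ 2) • C₂ + ((m : ℂ) ^ 3) •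
        tensorOp P V (weyl.x r) (slOp n V (rootVec i j h) * slOp n V (rootVec i j h)) := by
  set E := slOp n V (rootVec i j h)
  set A₀ := slOp n V (outer _ _ (pair_shift i j h r 0))
  set A₁ := slOp n V (outer _ _ (pair_shift i j h r 1) - outer _ _ (pair_shift i j h r 0) -
        rootVec i j h)
  set α₀ : weyl n := weyl.x r * ((r i : ℂ) • weyl.d j + (-(r j : ℂ)) • weyl.d i)
  set α₁ : weyl n := weyl.x r * weyl.d j + (r j : ℂ) • weyl.x r
  have hα : ∀ m : ℕ, toWeyl n (divFree.D _ _ (pair_shift i j h r m)) *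
      weyl.x (Pi.single i (m : ℤ)) = α₀ + (-(m : ℂ)) • α₁ := by
    intro m
    rw [toWeyl_mul_x, toWeyl_D, ← mul_assoc, x_mul_x, add_sub_cancel, sub_add_cancel,
      pair_sub_left, pair_single, pair_single]
    have hsum : ∑ l, (Pi.single j ((r i : ℂ) - m) - Pi.single i (r j : ℂ) : Fin n → ℂ) l •
        (weyl.d l : weyl n) =
        (r i : ℂ) • weyl.d j + (-(m : ℂ)) • weyl.d j + (-(r j : ℂ)) • weyl.d i := by
      simp [Pi.sub_apply, sub_eq_add_neg, add_smul, Finset.sum_add_distrib, Pi.single_apply,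
        ite_smul, apply_ite (fun c : ℂ => -c)]
    rw [hsum]
    simp only [α₀, α₁, Pi.single_eq_same, Pi.single_eq_of_ne h.symm, mul_add, mul_smul_comm,
      smul_add, smul_smul, Int.cast_zero, Int.cast_natCast, mul_zero, zero_sub]
    rw [show -((r j : ℂ) * m) = -(m : ℂ) * r j by ring]
    abel
  have hd : ∑ l, (Pi.single j 1 : Fin n → ℂ) l • (weyl.d l : weyl n) = weyl.d j := by
    simp [Pi.single_apply, ite_smul]
  refine ⟨tensorOp P V (α₀ * weyl.d j) 1 + tensorOp P V (weyl.x r * weyl.d j) A₀,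
    -tensorOp P V (α₁ * weyl.d j) 1 + tensorOp P V α₀ E + tensorOp P V (weyl.x r * weyl.d j) A₁ +
      tensorOp P V (weyl.x r) (A₀ * E),
    -tensorOp P V α₁ E + tensorOp P V (weyl.x r * weyl.d j) E + tensorOp P V (weyl.x r) (A₁ * E),
    fun m => ?_⟩
  rw [act_eq, act_eq, ← toWeyl_D _ _ (pair_shift i j h r m), hd, outer_single_single i j h,
    outer_shift i j h, add_mul, mul_add, mul_add, tensorOp_mul, tensorOp_mul, tensorOp_mul,
    tensorOp_mul,
    ← mul_assoc, ← mul_assoc, hα, x_mul_x, sub_add_cancel]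
  have hA : ∀ B C D : sl n, slOp n V (B + (m : ℂ) • C + ((m : ℂ) ^ 2) • D) =
      slOp n V B + (m : ℂ) • slOp n V C + ((m : ℂ) ^ 2) • slOp n V D := fun B C D => by
    rw [map_add, map_add, map_smul, map_smul]
  rw [hA, map_smul]
  simp only [map_add, map_smul, smul_mul_assoc, LinearMap.add_apply,
    LinearMap.smul_apply, one_mul, mul_one, add_mul, mul_smul_comm]
  module

end Operators

/-! ### Intertwined pairs of operators -/

section Intertwiners

variable {n : ℕ} {P P' V V' : Type*}
  [AddCommGroup P] [Module ℂ P] [Module (weyl n) P] [IsScalarTower ℂ (weyl n) P]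
  [AddCommGroup P'] [Module ℂ P'] [Module (weyl n) P'] [IsScalarTower ℂ (weyl n) P']
  [AddCommGroup V] [Module ℂ V] [AddCommGroup V'] [Module ℂ V']

/-- The pairs `(A, A')` of operators with `φ A = A' φ`. -/
def intertwined {M M' : Type*} [AddCommGroup M] [Module ℂ M] [AddCommGroup M'] [Module ℂ M']
    (φ : M →ₗ[ℂ] M') : Subalgebra ℂ (Module.End ℂ M × Module.End ℂ M') where
  carrier := {A | ∀ t, φ (A.1 t) = A.2 (φ t)}
  mul_mem' {A B} hA hB t := by
    change φ (A.1 (B.1 t)) = A.2 (B.2 (φ t))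
    rw [hA, hB]
  add_mem' {A B} hA hB t := by
    change φ (A.1 t + B.1 t) = A.2 (φ t) + B.2 (φ t)
    rw [map_add, hA, hB]
  algebraMap_mem' c t := by
    change φ (c • t) = c • φ t
    rw [map_smul]

variable (P P' V V') in
/-- The pair of operators `a ⊗ Y` on `P ⊗ V` and `a ⊗ Y'` on `P' ⊗ V'`. -/
def tensorPair (a : weyl n) :
    (Module.End ℂ V × Module.End ℂ V') →ₗ[ℂ]
      (Module.End ℂ (P ⊗[ℂ] V) × Module.End ℂ (P' ⊗[ℂ] V')) :=
  (tensorOp P V a).prodMap (tensorOp P' V' a)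

theorem tensorPair_apply (a : weyl n) (B : Module.End ℂ V × Module.End ℂ V') :
    tensorPair P P' V V' a B = (tensorOp P V a B.1, tensorOp P' V' a B.2) := rfl

theorem tensorPair_mul (a b : weyl n) (B C : Module.End ℂ V × Module.End ℂ V') :
    tensorPair P P' V V' a B * tensorPair P P' V V' b C = tensorPair P P' V V' (a * b) (B * C) :=
  Prod.ext (tensorOp_mul P V a b B.1 C.1) (tensorOp_mul P' V' a b B.2 C.2)

theorem tensorPair_add_left (a b : weyl n) (B : Module.End ℂ V × Module.End ℂ V') :
    tensorPair P P' V V' (a + b) B = tensorPair P P' V V' a B + tensorPair P P' V V' b B := by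
  simp [tensorPair_apply]

theorem tensorPair_smul_left (c : ℂ) (a : weyl n) (B : Module.End ℂ V × Module.End ℂ V') :
    tensorPair P P' V V' (c • a) B = c • tensorPair P P' V V' a B := by
  simp [tensorPair_apply]

variable (n) in
/-- The pairs `(B, B')` of operators on `V` and `V'` such that `φ` intertwines `a ⊗ B` and `a ⊗ B'`
for every differential operator `a`. -/
def weylIntertwined (φ : P ⊗[ℂ] V →ₗ[ℂ] P' ⊗[ℂ] V') :
    Submodule ℂ (Module.End ℂ V × Module.End ℂ V') :=
  ⨅ a : weyl n, (intertwined φ).toSubmodule.comap (tensorPair P P' V V' a)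

theorem mem_weylIntertwined {φ : P ⊗[ℂ] V →ₗ[ℂ] P' ⊗[ℂ] V'}
    {B : Module.End ℂ V × Module.End ℂ V'} :
    B ∈ weylIntertwined n φ ↔ ∀ a : weyl n, tensorPair P P' V V' a B ∈ intertwined φ := by
  simp [weylIntertwined]

/-- An induction principle for differential operators built up by left multiplication. -/
theorem weyl_induction_left {p : Submodule ℂ (weyl n)} (h1 : 1 ∈ p)
    (hx : ∀ r, ∀ a ∈ p, weyl.x r * a ∈ p) (hd : ∀ i, ∀ a ∈ p, weyl.d i * a ∈ p) (a : weyl n) :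
    a ∈ p := by
  suffices h : ∀ (b : Module.End ℂ (Laurent n)) (hb : b ∈ weyl n), ∀ a ∈ p,
      (⟨b, hb⟩ : weyl n) * a ∈ p by
    simpa using h a.1 a.2 1 h1
  intro b hb
  induction hb using Algebra.adjoin_induction with
  | mem b hb =>
    rcases hb with ⟨r, rfl⟩ | ⟨i, rfl⟩
    · exact hx r
    · exact hd i
  | algebraMap c =>
    intro a ha
    have : (⟨algebraMap ℂ _ c, Subalgebra.algebraMap_mem _ c⟩ : weyl n) * a = c • a :=
      (Algebra.smul_def c a).symm
    rw [this]
    exact p.smul_mem c ha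
  | add b c hb hc ihb ihc =>
    intro a ha
    have := p.add_mem (ihb a ha) (ihc a ha)
    rwa [← add_mul] at this
  | mul b c hb hc ihb ihc =>
    intro a ha
    have := ihb _ (ihc a ha)
    rwa [← mul_assoc] at this

theorem d_mul_x (i : Fin n) (r : Fin n → ℤ) :
    (weyl.d i * weyl.x r : weyl n) = weyl.x r * weyl.d i + (r i : ℂ) • weyl.x r := by
  have h : pair (Pi.single i (1 : ℂ)) (0 : Fin n → ℤ) = 0 := by simp [pair]
  have hD := toWeyl_mul_x (Pi.single i (1 : ℂ)) 0 r h
  rw [toWeyl_D, x_zero, one_mul, Finset.sum_eq_single i (fun j _ hj => by simp [hj]) (by simp),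
    Pi.single_eq_same, one_smul, pair_single, zero_add, one_mul] at hD
  exact hD

variable [LieRingModule (sl n) V] [LieModule ℂ (sl n) V] [LieRingModule (sl n) V']
  [LieModule ℂ (sl n) V']

variable (V V') in
/-- The pair of operators by which an element of `𝔰𝔩_n` acts on `V` and on `V'`. -/
def slPair : sl n →ₗ[ℂ] (Module.End ℂ V × Module.End ℂ V') := (slOp n V).prod (slOp n V')

variable (P P' V V') in
/-- The pair of operators by which an element of `𝕊_n` acts on `P ⊗ V` and on `P' ⊗ V'`. -/
def actPair : divFree n →ₗ[ℂ] (Module.End ℂ (P ⊗[ℂ] V) × Module.End ℂ (P' ⊗[ℂ] V')) :=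
  (act P V).prod (act P' V')

theorem actPair_D (u : Fin n → ℂ) (r : Fin n → ℤ) (h : pair u r = 0) :
    actPair P P' V V' (divFree.D u r h) =
      tensorPair P P' V V' (weyl.x r * ∑ i, u i • weyl.d i) 1 +
        tensorPair P P' V V' (weyl.x r) (slPair V V' (outer u r h)) :=
  Prod.ext (act_eq P V u r h) (act_eq P' V' u r h)

variable {φ : P ⊗[ℂ] V →ₗ[ℂ] P' ⊗[ℂ] V'}

/-- It suffices to test monomials: by `∂ᵢ ⊗ 1 = D(eᵢ, 0)`, intertwining for `x^r ⊗ B` propagates to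
all differential operators. -/
theorem mem_weylIntertwined_of_x (hφ : ∀ X : divFree n, actPair P P' V V' X ∈ intertwined φ)
    {B : Module.End ℂ V × Module.End ℂ V'}
    (hB : ∀ r : Fin n → ℤ, tensorPair P P' V V' (weyl.x r) B ∈ intertwined φ) :
    B ∈ weylIntertwined n φ := by
  have hd : ∀ i, tensorPair P P' V V' (weyl.d i : weyl n) 1 ∈ intertwined φ := fun i => by
    have h : pair (Pi.single i (1 : ℂ)) (0 : Fin n → ℤ) = 0 := by simp [pair]
    have := hφ (divFree.D _ _ h)
    rwa [show actPair P P' V V' (divFree.D _ _ h) = tensorPair P P' V V' (weyl.d i) 1 from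
      Prod.ext (act_euler P V i h) (act_euler P' V' i h)] at this
  let p : Submodule ℂ (weyl n) :=
    { carrier := {a | ∀ s, tensorPair P P' V V' (weyl.x s * a) B ∈ intertwined φ}
      add_mem' := fun {a b} ha hb s => by
        rw [mul_add, tensorPair_add_left]; exact add_mem (ha s) (hb s)
      zero_mem' := fun s => by
        rw [mul_zero, tensorPair_apply, map_zero, map_zero]; exact zero_mem _
      smul_mem' := fun c a ha s => by
        rw [mul_smul_comm, tensorPair_smul_left]; exact Subalgebra.smul_mem _ (ha s) c }
  refine mem_weylIntertwined.2 fun a => ?_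
  have ha : a ∈ p := by
    refine weyl_induction_left (fun s => ?_) (fun r a ha s => ?_) (fun i a ha s => ?_) a
    · rw [mul_one]; exact hB s
    · rw [← mul_assoc, x_mul_x]; exact ha _
    · have h1 : (weyl.x s * (weyl.d i * a) : weyl n) =
          weyl.d i * (weyl.x s * a) + (-(s i : ℂ)) • (weyl.x s * a) := by
        rw [← mul_assoc, ← mul_assoc, d_mul_x, add_mul, smul_mul_assoc, add_assoc, ← add_smul,
          add_neg_cancel, zero_smul, add_zero]
      rw [h1, tensorPair_add_left, tensorPair_smul_left]
      refine add_mem ?_ (Subalgebra.smul_mem _ (ha s) _)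
      have := mul_mem (hd i) (ha s)
      rwa [tensorPair_mul, one_mul] at this
  simpa [x_zero] using ha 0

/-- The third difference in `m` of the cubic polynomial of `exists_act_mul_act` isolates the leading
coefficient `x^r ⊗ E_ij²`. -/
theorem sq_mem_weylIntertwined (hφ : ∀ X : divFree n, actPair P P' V V' X ∈ intertwined φ)
    (i j : Fin n) (h : i ≠ j) :
    slPair V V' (rootVec i j h) * slPair V V' (rootVec i j h) ∈ weylIntertwined n φ := by
  refine mem_weylIntertwined_of_x hφ fun r => ?_
  obtain ⟨C₀, C₁, C₂, hC⟩ := exists_act_mul_act P V i j h r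
  obtain ⟨C₀', C₁', C₂', hC'⟩ := exists_act_mul_act P' V' i j h r
  set F : ℕ → Module.End ℂ (P ⊗[ℂ] V) × Module.End ℂ (P' ⊗[ℂ] V') := fun m =>
    actPair P P' V V' (divFree.D _ _ (pair_shift i j h r m)) *
      actPair P P' V V' (divFree.D _ _ (pair_single_single i j h m)) with hF
  set T := tensorPair P P' V V' (weyl.x r)
    (slPair V V' (rootVec i j h) * slPair V V' (rootVec i j h)) with hT
  have hFm : ∀ m : ℕ, F m = (C₀, C₀') + (m : ℂ) • (C₁, C₁') + ((m : ℂ) ^ 2) • (C₂, C₂') +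
      ((m : ℂ) ^ 3) • T := fun m => Prod.ext (hC m) (hC' m)
  have hmem : ∀ m, F m ∈ intertwined φ := fun m => mul_mem (hφ _) (hφ _)
  have hdiff : T = (1 / 6 : ℂ) • (F 3 + (-3 : ℂ) • F 2 + (3 : ℂ) • F 1 + (-1 : ℂ) • F 0) := by
    simp only [hFm]
    push_cast
    module
  rw [hdiff]
  have hs : ∀ (c : ℂ) (m : ℕ), c • F m ∈ intertwined φ :=
    fun c m => Subalgebra.smul_mem _ (hmem m) c
  exact Subalgebra.smul_mem _ (add_mem (add_mem (add_mem (hmem 3) (hs _ 2)) (hs _ 1)) (hs _ 0)) _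

/-- The operator `D(u, r)(x^{-r} a ⊗ B)` is the sum of `D(u, r) x^{-r} a ⊗ B` and
`a ⊗ (r uᵀ) B`. -/
theorem outer_mul_mem (hφ : ∀ X : divFree n, actPair P P' V V' X ∈ intertwined φ)
    {B : Module.End ℂ V × Module.End ℂ V'} (hB : B ∈ weylIntertwined n φ) (u : Fin n → ℂ)
    (r : Fin n → ℤ) (h : pair u r = 0) :
    slPair V V' (outer u r h) * B ∈ weylIntertwined n φ := by
  rw [mem_weylIntertwined] at hB ⊢
  intro a
  have h1 := mul_mem (hφ (divFree.D u r h)) (hB (weyl.x (-r) * a))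
  rw [actPair_D, add_mul, tensorPair_mul, tensorPair_mul, one_mul,
    ← mul_assoc (weyl.x r) (weyl.x (-r)), x_mul_x, add_neg_cancel, x_zero, one_mul] at h1
  simpa using sub_mem h1 (hB (weyl.x r * (∑ i, u i • weyl.d i) * (weyl.x (-r) * a)))

/-- The Lie algebra `𝔰𝔩_n` is spanned by the matrices `r uᵀ` with `r ∈ ℤⁿ` and `(u | r) = 0`. -/
theorem mem_of_outer_mem {W : Submodule ℂ (sl n)} (h : ∀ u r h, outer u r h ∈ W) (A : sl n) :
    A ∈ W := by
  have hroot : ∀ i j h, rootVec i j h ∈ W := fun i j hij => by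
    have := h _ _ (pair_single_single i j hij 1)
    rwa [outer_single_single, Nat.cast_one, one_smul] at this
  have hcoroot : ∀ i j, coroot i j ∈ W := fun i j => by
    by_cases hij : i = j
    · subst hij
      have : coroot i i = 0 := Subtype.ext (by rw [coroot_val, sub_self]; rfl)
      rw [this]; exact zero_mem _
    have hp : pair (Pi.single i 1 - Pi.single j 1) (Pi.single i 1 + Pi.single j 1) = 0 := by
      rw [pair_sub_left, pair_single, pair_single]
      simp [hij, Ne.symm hij]
    have hc : coroot i j = outer _ _ hp + rootVec i j hij - rootVec j i (Ne.symm hij) := by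
      refine Subtype.ext ?_
      change _ = (outer _ _ hp).1 + (rootVec i j hij).1 - (rootVec j i (Ne.symm hij)).1
      rw [coroot_val, rootVec_val, rootVec_val]
      have hs : ∀ k l a b : Fin n, (Matrix.single k l (1 : ℂ)) a b =
          (Pi.single k (1 : ℂ) : Fin n → ℂ) a * (Pi.single l (1 : ℂ) : Fin n → ℂ) b := by
        intro k l a b
        by_cases ha : a = k <;> by_cases hb : b = l <;> simp [ha, hb, Ne.symm]
      have hz : ∀ k a : Fin n, (((Pi.single k 1 : Fin n → ℤ) a : ℤ) : ℂ) =
          (Pi.single k (1 : ℂ) : Fin n → ℂ) a := by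
        intro k a
        by_cases ha : a = k
        · subst ha; simp
        · simp [ha]
      ext a b
      simp only [outer, Matrix.add_apply, Matrix.sub_apply, Matrix.vecMulVec_apply, hs,
        Pi.sub_apply, Pi.add_apply, Int.cast_add, hz]
      ring
    rw [hc]
    exact sub_mem (add_mem (h _ _ hp) (hroot _ _ _)) (hroot _ _ _)
  by_cases hn : n = 0
  · subst hn
    have : A = 0 := Subtype.ext (by ext i; exact i.elim0)
    rw [this]; exact zero_mem _
  rw [sl_eq_sum A ⟨0, Nat.pos_of_ne_zero hn⟩]
  refine sum_mem fun i _ => sum_mem fun j _ => W.smul_mem _ ?_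
  by_cases hij : i = j
  · subst hij; rw [tracelessUnit_self]; exact hcoroot _ _
  · rw [tracelessUnit_of_ne _ i j hij]; exact hroot _ _ _

theorem slPair_mul_mem (hφ : ∀ X : divFree n, actPair P P' V V' X ∈ intertwined φ)
    {B : Module.End ℂ V × Module.End ℂ V'} (hB : B ∈ weylIntertwined n φ) (A : sl n) :
    slPair V V' A * B ∈ weylIntertwined n φ :=
  mem_of_outer_mem (W := (weylIntertwined n φ).comap
    ((LinearMap.mulRight ℂ B).comp (slPair V V'))) (outer_mul_mem hφ hB) A

/-- If `V` is irreducible and not square-zero, then `φ` commutes with all operators `a ⊗ 1`: the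
images of the first components `B` of the intertwined pairs span a nonzero submodule of `V`, so
every vector of `V` is a sum of vectors `B y`, and `(a ⊗ 1)(1 ⊗ B) = a ⊗ B`. -/
theorem one_mem_weylIntertwined (hφ : ∀ X : divFree n, actPair P P' V V' X ∈ intertwined φ)
    (hV : LieModule.IsIrreducible ℂ (sl n) V) (hsq : ¬ SquareZero (n := n) V) :
    (1 : Module.End ℂ V × Module.End ℂ V') ∈ weylIntertwined n φ := by
  let W : LieSubmodule ℂ (sl n) V :=
    { Submodule.span ℂ {y | ∃ B ∈ weylIntertwined n φ, ∃ y₀, y = B.1 y₀} with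
      lie_mem := by
        intro A y hy
        change y ∈ Submodule.span ℂ {y | ∃ B ∈ weylIntertwined n φ, ∃ y₀, y = B.1 y₀} at hy
        change ⁅A, y⁆ ∈ Submodule.span ℂ {y | ∃ B ∈ weylIntertwined n φ, ∃ y₀, y = B.1 y₀}
        induction hy using Submodule.span_induction with
        | mem y h =>
          obtain ⟨B, hB, y₀, rfl⟩ := h
          exact Submodule.subset_span ⟨_, slPair_mul_mem hφ hB A, y₀, rfl⟩
        | zero => rw [lie_zero]; exact zero_mem _
        | add x y _ _ hx hy => rw [lie_add]; exact add_mem hx hy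
        | smul c x _ hx => rw [lie_smul]; exact Submodule.smul_mem _ _ hx }
  have hW : W = ⊤ := (eq_bot_or_eq_top W).resolve_left fun hW => hsq fun i j h m => by
    have : ⁅rootVec i j h, ⁅rootVec i j h, m⁆⁆ ∈ W :=
      Submodule.subset_span ⟨_, sq_mem_weylIntertwined hφ i j h, m, rfl⟩
    rwa [hW, LieSubmodule.mem_bot] at this
  refine mem_weylIntertwined.2 fun a t => ?_
  change φ (tensorOp P V a 1 t) = tensorOp P' V' a 1 (φ t)
  induction t using TensorProduct.induction_on with
  | zero => simp
  | add s t hs ht => rw [map_add, map_add, hs, ht, map_add, map_add]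
  | tmul z y =>
    have hy : y ∈ W := hW ▸ LieSubmodule.mem_top y
    replace hy : y ∈ Submodule.span ℂ {y | ∃ B ∈ weylIntertwined n φ, ∃ y₀, y = B.1 y₀} := hy
    induction hy using Submodule.span_induction with
    | zero => simp
    | add x y _ _ hx hy => simp only [TensorProduct.tmul_add, map_add, hx, hy]
    | smul c x _ hx => simp only [TensorProduct.tmul_smul, map_smul, hx]
    | mem y h =>
      obtain ⟨B, hB, y₀, rfl⟩ := h
      rw [mem_weylIntertwined] at hB
      have h1 : φ (tensorOp P V 1 B.1 (z ⊗ₜ y₀)) = tensorOp P' V' 1 B.2 (φ (z ⊗ₜ y₀)) :=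
        hB 1 (z ⊗ₜ y₀)
      have h2 : φ (tensorOp P V a B.1 (z ⊗ₜ y₀)) = tensorOp P' V' a B.2 (φ (z ⊗ₜ y₀)) :=
        hB a (z ⊗ₜ y₀)
      have h3 := LinearMap.congr_fun (tensorOp_mul P' V' a 1 1 B.2) (φ (z ⊗ₜ y₀))
      rw [mul_one, one_mul, Module.End.mul_apply, ← h1, ← h2] at h3
      simpa [tensorOp_tmul] using h3.symm

end Intertwiners

/-! ### Recovering the tensor factors -/

section Contraction

variable {P V : Type*} [AddCommGroup P] [Module ℂ P] [AddCommGroup V] [Module ℂ V]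

variable (P) in
/-- The contraction `z ⊗ y ↦ ℓ(y) z` with a linear form `ℓ` on `V`. -/
def contractRight (ℓ : Module.Dual ℂ V) : P ⊗[ℂ] V →ₗ[ℂ] P :=
  (TensorProduct.rid ℂ P).toLinearMap ∘ₗ ℓ.lTensor P

variable (V) in
/-- The contraction `z ⊗ y ↦ λ(z) y` with a linear form `λ` on `P`. -/
def contractLeft (l : Module.Dual ℂ P) : P ⊗[ℂ] V →ₗ[ℂ] V :=
  (TensorProduct.lid ℂ V).toLinearMap ∘ₗ l.rTensor V

theorem contractRight_tmul (ℓ : Module.Dual ℂ V) (z : P) (y : V) :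
    contractRight P ℓ (z ⊗ₜ y) = ℓ y • z := by
  simp [contractRight]

theorem contractLeft_tmul (l : Module.Dual ℂ P) (z : P) (y : V) :
    contractLeft V l (z ⊗ₜ y) = l z • y := by
  simp [contractLeft]

theorem exists_contractRight_ne_zero {t : P ⊗[ℂ] V} (ht : t ≠ 0) :
    ∃ ℓ, contractRight P ℓ t ≠ 0 := by
  classical
  let b := Module.Basis.ofVectorSpace ℂ V
  by_contra! h
  refine ht ((TensorProduct.equivFinsuppOfBasisRight b).map_eq_zero_iff.1 (Finsupp.ext fun i => ?_))
  have hi : ∀ s : P ⊗[ℂ] V,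
      TensorProduct.equivFinsuppOfBasisRight b s i = contractRight P (b.coord i) s := by
    intro s
    induction s using TensorProduct.induction_on with
    | zero => simp
    | add s t hs ht => rw [map_add, map_add, Finsupp.add_apply, hs, ht]
    | tmul z y => simp [contractRight_tmul]
  rw [hi, h, Finsupp.zero_apply]

theorem exists_contractLeft_ne_zero {t : P ⊗[ℂ] V} (ht : t ≠ 0) :
    ∃ l, contractLeft V l t ≠ 0 := by
  obtain ⟨l, hl⟩ := exists_contractRight_ne_zero
    (t := TensorProduct.comm ℂ P V t) (by simpa using ht)
  refine ⟨l, fun h => hl (h ▸ ?_)⟩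
  clear h hl ht
  induction t using TensorProduct.induction_on with
  | zero => simp
  | add s t hs ht => simp only [map_add, hs, ht]
  | tmul z y => simp [contractRight_tmul, contractLeft_tmul]

theorem tmul_ne_zero {z : P} {y : V} (hz : z ≠ 0) (hy : y ≠ 0) : z ⊗ₜ[ℂ] y ≠ 0 := by
  intro h
  obtain ⟨ℓ, hℓ⟩ : ∃ ℓ : Module.Dual ℂ V, ℓ y ≠ 0 := by
    by_contra! h
    exact hy ((Module.forall_dual_apply_eq_zero_iff ℂ y).1 h)
  have := contractRight_tmul ℓ z y
  rw [h, map_zero] at this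
  exact smul_ne_zero hℓ hz this.symm

end Contraction

section Recover

variable {n : ℕ} {P P' V V' : Type*}
  [AddCommGroup P] [Module ℂ P] [Module (weyl n) P] [IsScalarTower ℂ (weyl n) P]
  [AddCommGroup P'] [Module ℂ P'] [Module (weyl n) P'] [IsScalarTower ℂ (weyl n) P']
  [AddCommGroup V] [Module ℂ V] [AddCommGroup V'] [Module ℂ V']

theorem contractRight_tensorOp (ℓ : Module.Dual ℂ V) (a : weyl n) (t : P ⊗[ℂ] V) :
    contractRight P ℓ (tensorOp P V a 1 t) = a • contractRight P ℓ t := by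
  induction t using TensorProduct.induction_on with
  | zero => simp
  | add s t hs ht => simp only [map_add, hs, ht, smul_add]
  | tmul z y => simp only [tensorOp_tmul, Module.End.one_apply, contractRight_tmul, smul_comm a]

theorem contractLeft_tensorOp (l : Module.Dual ℂ P) (Y : Module.End ℂ V) (t : P ⊗[ℂ] V) :
    contractLeft V l (tensorOp P V (1 : weyl n) Y t) = Y (contractLeft V l t) := by
  induction t using TensorProduct.induction_on with
  | zero => simp
  | add s t hs ht => simp only [map_add, hs, ht]
  | tmul z y => simp only [tensorOp_tmul, one_smul, contractLeft_tmul, map_smul]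

variable {φ : P ⊗[ℂ] V →ₗ[ℂ] P' ⊗[ℂ] V'}

/-- Contracting the values of `φ` with a suitable linear form on `V'` gives a nonzero homomorphism
between simple modules. -/
theorem nonempty_weyl_equiv (hP : IsSimpleModule (weyl n) P) (hP' : IsSimpleModule (weyl n) P')
    (h1 : (1 : Module.End ℂ V × Module.End ℂ V') ∈ weylIntertwined n φ)
    {z : P} {y : V} (hzy : φ (z ⊗ₜ y) ≠ 0) : Nonempty (P ≃ₗ[weyl n] P') := by
  obtain ⟨ℓ, hℓ⟩ := exists_contractRight_ne_zero hzy
  let f : P →ₗ[weyl n] P' :=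
    { toFun := fun z => contractRight P' ℓ (φ (z ⊗ₜ y))
      map_add' := fun z z' => by rw [TensorProduct.add_tmul, map_add, map_add]
      map_smul' := fun a z => by
        have h : φ (tensorOp P V a 1 (z ⊗ₜ y)) = tensorOp P' V' a 1 (φ (z ⊗ₜ y)) :=
          mem_weylIntertwined.1 h1 a (z ⊗ₜ y)
        rw [RingHom.id_apply, ← contractRight_tensorOp, ← h, tensorOp_tmul, Module.End.one_apply] }
  have hf : f ≠ 0 := fun h => hℓ (LinearMap.congr_fun h z)
  exact ⟨LinearEquiv.ofBijective f (LinearMap.bijective_of_ne_zero (R := weyl n) (f := f) hf)⟩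

variable [LieRingModule (sl n) V] [LieModule ℂ (sl n) V] [LieRingModule (sl n) V']
  [LieModule ℂ (sl n) V']

theorem nonempty_sl_equiv (hV : LieModule.IsIrreducible ℂ (sl n) V)
    (hV' : LieModule.IsIrreducible ℂ (sl n) V')
    (hsl : ∀ A : sl n, slPair V V' A ∈ weylIntertwined n φ)
    {z : P} {y : V} (hzy : φ (z ⊗ₜ y) ≠ 0) : Nonempty (V ≃ₗ⁅ℂ, sl n⁆ V') := by
  obtain ⟨l, hl⟩ : ∃ l, contractLeft V' l (φ (z ⊗ₜ y)) ≠ 0 := exists_contractLeft_ne_zero hzy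
  let f : V →ₗ⁅ℂ, sl n⁆ V' :=
    { contractLeft V' l ∘ₗ φ ∘ₗ TensorProduct.mk ℂ P V z with
      map_lie' := fun {A y} => by
        have h : φ (tensorOp P V (1 : weyl n) (slOp n V A) (z ⊗ₜ y)) =
            tensorOp P' V' (1 : weyl n) (slOp n V' A) (φ (z ⊗ₜ y)) :=
          mem_weylIntertwined.1 (hsl A) 1 (z ⊗ₜ y)
        rw [tensorOp_tmul, one_smul] at h
        change contractLeft V' l (φ (z ⊗ₜ (slOp n V A y))) =
          slOp n V' A (contractLeft V' l (φ (z ⊗ₜ y)))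
        rw [h, contractLeft_tensorOp] }
  exact nonempty_lieModuleEquiv_of_ne_zero hV hV' f y hl

/-- Isomorphisms of the tensor factors induce an isomorphism of `𝕊_n`-modules. -/
theorem nonempty_tensorModule_equiv (e : P ≃ₗ[weyl n] P') (f : V ≃ₗ⁅ℂ, sl n⁆ V') :
    Nonempty (TensorModule n P V ≃ₗ⁅ℂ, divFree n⁆ TensorModule n P' V') := by
  let eℂ : P ≃ₗ[ℂ] P' := e.restrictScalars ℂ
  let fℂ : V ≃ₗ[ℂ] V' := f.toLinearEquiv
  let g : P ⊗[ℂ] V ≃ₗ[ℂ] P' ⊗[ℂ] V' := TensorProduct.congr eℂ fℂ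
  have hg : ∀ (X : divFree n) (t : P ⊗[ℂ] V), g (act P V X t) = act P' V' X (g t) := by
    intro X t
    induction X using divFree_induction with
    | h0 => simp
    | ha X Y hX hY => simp only [map_add, LinearMap.add_apply, hX, hY]
    | hs c X hX => simp only [map_smul, LinearMap.smul_apply, hX]
    | hm u r h =>
      induction t using TensorProduct.induction_on with
      | zero => simp
      | add s t hs ht => simp only [map_add, hs, ht]
      | tmul z y =>
        have he : ∀ (a : weyl n) z, eℂ (a • z) = a • eℂ z := fun a z => e.map_smul a z
        have hf : ∀ (A : sl n) y, fℂ ⁅A, y⁆ = ⁅A, fℂ y⁆ := fun A y => f.toLieModuleHom.map_lie A y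
        simp only [act_D, g, map_add, TensorProduct.congr_tmul, he, hf]
  exact ⟨{ g with map_lie' := fun {X t} => hg X t }⟩

end Recover

end TorusVF

end

/-- Isomorphism criterion for the `𝕊_n`-modules `F(P, V)` with `V` not isomorphic to any
`V(δ_k) = ⋀^k(ℂⁿ)`, `0 ≤ k ≤ n - 1`. -/
theorem mainTheorem2 (n : ℕ) (hn : 2 ≤ n)
    {P P' V V' : Type*}
    [AddCommGroup P] [Module ℂ P] [Module (TorusVF.weyl n) P] [IsScalarTower ℂ (TorusVF.weyl n) P]
    [AddCommGroup P'] [Module ℂ P'] [Module (TorusVF.weyl n) P']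
    [IsScalarTower ℂ (TorusVF.weyl n) P']
    [AddCommGroup V] [Module ℂ V] [LieRingModule (TorusVF.sl n) V] [LieModule ℂ (TorusVF.sl n) V]
    [AddCommGroup V'] [Module ℂ V'] [LieRingModule (TorusVF.sl n) V']
    [LieModule ℂ (TorusVF.sl n) V']
    (hP : IsSimpleModule (TorusVF.weyl n) P) (hP' : IsSimpleModule (TorusVF.weyl n) P')
    (hV : LieModule.IsIrreducible ℂ (TorusVF.sl n) V)
    (hV' : LieModule.IsIrreducible ℂ (TorusVF.sl n) V')
    (hVk : ∀ k : ℕ, k < n → ¬ Nonempty (V ≃ₗ⁅ℂ, TorusVF.sl n⁆ TorusVF.ExtPow n k)) :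
    Nonempty (TorusVF.TensorModule n P V ≃ₗ⁅ℂ, TorusVF.divFree n⁆ TorusVF.TensorModule n P' V') ↔
      Nonempty (P ≃ₗ[TorusVF.weyl n] P') ∧ Nonempty (V ≃ₗ⁅ℂ, TorusVF.sl n⁆ V') := by
  constructor
  · rintro ⟨Φ⟩
    let φ : P ⊗[ℂ] V →ₗ[ℂ] P' ⊗[ℂ] V' := Φ.toLieModuleHom.toLinearMap
    have hφ : ∀ X : TorusVF.divFree n, TorusVF.actPair P P' V V' X ∈ TorusVF.intertwined φ :=
      fun X t => Φ.toLieModuleHom.map_lie X t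
    have hsq : ¬ TorusVF.SquareZero (n := n) V := fun h => by
      obtain ⟨k, hk, hk'⟩ := h.exists_equiv_extPow (by omega) hV
      exact hVk k hk hk'
    have h1 := TorusVF.one_mem_weylIntertwined hφ hV hsq
    have hsl : ∀ A : TorusVF.sl n, TorusVF.slPair V V' A ∈ TorusVF.weylIntertwined n φ :=
      fun A => by simpa using TorusVF.slPair_mul_mem hφ h1 A
    have : Nontrivial P := IsSimpleModule.nontrivial (TorusVF.weyl n) P
    have : Nontrivial V := LieModule.nontrivial_of_isIrreducible ℂ (TorusVF.sl n) V
    obtain ⟨z, hz⟩ := exists_ne (0 : P)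
    obtain ⟨y, hy⟩ := exists_ne (0 : V)
    have hzy : φ (z ⊗ₜ y) ≠ 0 := fun h =>
      TorusVF.tmul_ne_zero hz hy (Φ.injective (h.trans (map_zero φ).symm))
    exact ⟨TorusVF.nonempty_weyl_equiv hP hP' h1 hzy, TorusVF.nonempty_sl_equiv hV hV' hsl hzy⟩
  · rintro ⟨⟨e⟩, ⟨f⟩⟩
    exact TorusVF.nonempty_tensorModule_equiv e f
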